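/- **Definitions.** Let $G$ be a finite simple graph. In the $q$-analogue zero forcing game on $G$, with $F$ the current set of filled vertices, the player may (Rule 1) fill any vertex at the cost of one token; (Rule 2) let a filled vertex with a unique unfilled neighbour fill that neighbour, at no cost; (Rule 3) announce at least $q+1$ connected components of $G[V\setminus F]$, whereupon the oracle picks a nonempty subset $\{U_1,\dots,U_l\}$ of them and the player may apply the forcing rule once in $G[F\cup U_1\cup\dots\cup U_l]$, at no cost. $Z_q(G)$ is the least number of tokens with which the player can fill all vertices against every oracle. $Z_+(G)$ is the least size of a set from which all vertices get filled by repeating the rule: an unfilled vertex $v$ with a filled neighbour $u$ is filled if no other unfilled neighbour of $u$ is joined to $v$ by a path of unfilled vertices. A connected *cactus graph* is a connected graph in which each edge lies in at most one cycle. Its *nodes* are its cycles and its *singular* vertices (those on no cycle). A *cycle/vertex tree* of $G$ is a tree $T$ whose vertices are the nodes and in which any two adjacent nodes either share a vertex of $G$ or are joined by a bridge of $G$. If $T$ is rooted at a node, the values $Z_0(C,i,j)\in\mathbb N\cup\{\infty\}$, $i\in\{0,1\}$, $j\in\{0,1,2\}$ ($i$ counts the free filled vertices from the parent of $C$ and $j$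 those from its children), are given by the following recurrence, in which $f_i(S)=\min_{k\in\{0,1,2\}} Z_0(S,i,k)$, the sums and minima are over the children $S$, $H\ne Q$ of $C$, a minimum over the empty set is $\infty$, and the values not listed are $\infty$. If $C$ is a cycle, $$Z_0(C,0,0)=2+\sum_S f_1(S),\qquad Z_0(C,0,1)=1+\min_H\Big(\sum_{S\ne H} f_1(S)+f_0(H)\Big),$$ $$Z_0(C,0,2)=\min_{H\ne Q}\Big(\sum_{S\ne H,Q} f_1(S)+f_0(H)+f_0(Q)\Big),$$ $$Z_0(C,1,0)=1+\sum_S f_1(S),\qquad Z_0(C,1,1)=\min_H\Big(\sum_{S\ne H} f_1(S)+f_0(H)\Big).$$ If $C$ is a singular vertex, $$Z_0(C,0,0)=1+\sum_S f_1(S),\quad Z_0(C,0,1)=\min_H\Big(\sum_{S\ne H} f_1(S)+f_0(H)\Big),\quad Z_0(C,1,0)=\sum_S f_1(S).$$ **Theorem.** Let $G$ be a connected cactus graph with $n$ vertices. 1. $Z_+(G)=Z_0(G)$, $G$ has a cycle/vertex tree, and for every cycle/vertex tree $T$ of $G$, $$Z_0(G)=\min_{C}\ \min_{k\in\{0,1,2\}}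 Z_0(C,0,k),$$ where $C$ runs over the nodes and $Z_0(C,0,k)$ is computed in $T$ rooted at $C$. Moreover, for every rooting of $T$ and every node $C$, let $G_C$ be the subgraph of $G$ induced by the vertices in the nodes of the subtree rooted at $C$; then $\min_k Z_0(C,0,k)=Z_0(G_C)$, and if $C$ has a parent $P$ and $p$ is a vertex of $C$ that lies on $P$ or is joined to a vertex of $P$ by a bridge, then $\min_k Z_0(C,1,k)$ is the least number of tokens that fill $G_C$ in the game with $q=0$ when $p$ is already filled at the start. 2. Evaluating the recurrence from the leaves to the root in $T$, scanning the children of each node once to find $\sum_S f_1(S)$ and the two smallest values of $f_0(S)-f_1(S)$, yields all these values, and over all choices of the root this takes $O(n^2)$ steps (node visits, additions, subtractions, comparisons). 3. There is a program for a random access machine with words of $O(\log n)$ bits (unit-cost addition, truncated subtraction, comparison and memory access) that computes $Z_0(G)=Z_+(G)$ from the adjacency matrix of $G$ in $O(n^2)$ steps. -/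

import Mathlib

universe u

/-! ### The `q`-analogue zero forcing game and positive semidefinite zero forcing -/

section Games

variable {V : Type u} (G : SimpleGraph V)

/-- The connected components of the subgraph induced by the unfilled vertices, when `F` is the
set of filled vertices. -/
abbrev UnfilledComponent (F : Set V) : Type u := (G.induce Fᶜ).ConnectedComponent

/-- The union of the vertex sets of a collection of components of unfilled vertices. -/
def componentVerts (F : Set V) (W : Set (UnfilledComponent G F)) : Set V :=
  {x | ∃ h : x ∈ Fᶜ, (G.induce Fᶜ).connectedComponentMk ⟨x, h⟩ ∈ W}

/-- With `F` the filled vertices and `U` a set of unfilled vertices, in the subgraph induced by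
`F ∪ U` the filled vertex `x` has `v` as its unique unfilled neighbour. -/
def CanForce (F U : Set V) (x v : V) : Prop :=
  x ∈ F ∧ v ∈ U ∧ G.Adj x v ∧ ∀ w ∈ U, G.Adj x w → w = v

/-- `PlayerWins G q k F`: if the filled vertices are those in `F`, then the player of the
`q`-analogue zero forcing game has a strategy that fills all vertices at the cost of at most `k`
further tokens, whatever the oracle does. -/
inductive PlayerWins (q : ℕ) : ℕ → Set V → Prop
  /-- All vertices are filled. -/
  | done (k : ℕ) : PlayerWins q k Set.univ
  /-- Rule 1: fill any vertex at the cost of one token. -/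
  | token (k : ℕ) (F : Set V) (v : V) :
      PlayerWins q k (insert v F) → PlayerWins q (k + 1) F
  /-- Rule 2: a filled vertex with a unique unfilled neighbour forces that neighbour. -/
  | force (k : ℕ) (F : Set V) (x v : V) :
      CanForce G F Fᶜ x v → PlayerWins q k (insert v F) → PlayerWins q k F
  /-- Rule 3: the player announces a set `A` of at least `q + 1` components of the unfilled
  vertices, the oracle answers with a nonempty subset `W` of `A`, and the player may apply the
  forcing rule in the subgraph induced by the filled vertices and the components in `W`.
  `next W` is the set of filled vertices after that. -/
  | oracle (k : ℕ) (F : Set V) (A : Set (UnfilledComponent G F))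
      (next : Set (UnfilledComponent G F) → Set V) :
      ((q + 1 : ℕ) : ℕ∞) ≤ A.encard →
      (∀ W, W ⊆ A → W.Nonempty →
        next W = F ∨ ∃ x v, CanForce G F (componentVerts G F W) x v ∧ next W = insert v F) →
      (∀ W, W ⊆ A → W.Nonempty → PlayerWins q k (next W)) →
      PlayerWins q k F

/-- The minimum number of tokens that fill all vertices in the `q`-analogue zero forcing game
when the vertices in `F` are already filled at the start. -/
noncomputable def tokensNeeded (q : ℕ) (F : Set V) : ℕ := sInf {k | PlayerWins G q k F}

/-- The `q`-analogue zero forcing number `Z_q(G)`. -/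
noncomputable def Zq (q : ℕ) : ℕ := tokensNeeded G q ∅

/-- `PSDReach G F F'`: starting from the filled set `F`, repeated application of the positive
semidefinite colour change rule can lead to the filled set `F'`.  The rule: an unfilled vertex
`v` can be filled if it has a filled neighbour `x` such that no other unfilled neighbour `w` of
`x` is joined to `v` by a path of unfilled vertices. -/
inductive PSDReach : Set V → Set V → Prop
  | refl (F : Set V) : PSDReach F F
  | step (F F' : Set V) (x v : V) (hv : v ∈ Fᶜ) :
      x ∈ F → G.Adj x v →
      (∀ (w : V) (hw : w ∈ Fᶜ), G.Adj x w → w ≠ v →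
        ¬ (G.induce Fᶜ).Reachable ⟨w, hw⟩ ⟨v, hv⟩) →
      PSDReach (insert v F) F' → PSDReach F F'

/-- The positive semidefinite zero forcing number `Z_+(G)`. -/
noncomputable def ZPlus : ℕ :=
  sInf {k | ∃ S : Finset V, S.card = k ∧ PSDReach G (S : Set V) Set.univ}

end Games

/-! ### Cactus graphs and their trees of cycles and singular vertices -/

section Cactus

variable {V : Type u} (G : SimpleGraph V)

/-- Each edge belongs to at most one cycle: two cycles with a common edge have the same edges. -/
def IsCactus : Prop :=
  ∀ ⦃x y : V⦄ (p : G.Walk x x) (q : G.Walk y y), p.IsCycle → q.IsCycle →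
    ∀ e, e ∈ p.edges → e ∈ q.edges → ∀ e', e' ∈ p.edges ↔ e' ∈ q.edges

/-- `s` is the vertex set of a cycle of `G`. -/
def IsCycleSet (s : Set V) : Prop :=
  ∃ (x : V) (p : G.Walk x x), p.IsCycle ∧ s = {y | y ∈ p.support}

/-- `s` consists of one vertex, and this vertex is on no cycle of `G`. -/
def IsSingularSet (s : Set V) : Prop :=
  ∃ v : V, s = {v} ∧ ∀ t, IsCycleSet G t → v ∉ t

/-- The nodes of the cycle/vertex tree: the cycles (given by their vertex sets; in a cactus
distinct cycles share at most one vertex) and the singular vertices. -/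
abbrev CactusNode : Type u := {s : Set V // IsCycleSet G s ∨ IsSingularSet G s}

noncomputable instance [Finite V] : Fintype (CactusNode G) := Fintype.ofFinite _

/-- The vertex `p` of the node `A` is where `A` is attached to the node `B`: either `p` also lies
on `B`, or `p` is joined to a vertex of `B` by an edge that lies on no cycle (a bridge). -/
def AttachedAt (A B : CactusNode G) (p : V) : Prop :=
  p ∈ A.1 ∧ (p ∈ B.1 ∨ ∃ b ∈ B.1, G.Adj p b ∧ G.IsBridge s(p, b))

/-- `T` is a representation of `G` as a tree of cycles and singular vertices: `T` is a tree whose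
nodes are these, and neighbouring nodes share a vertex of `G` or are joined by a bridge of `G`.
(If several nodes meet at one vertex of `G`, there are several such trees.) -/
def IsTreeRep (T : SimpleGraph (CactusNode G)) : Prop :=
  T.IsTree ∧ ∀ A B, T.Adj A B → ∃ p, AttachedAt G A B p

end Cactus

/-! ### Recursion along a rooted tree -/

section Rooted

variable {ν : Type u} [Fintype ν] (T : SimpleGraph ν)

open Classical in
/-- The children of `C` when the tree `T` is rooted at `r`. -/
noncomputable def children (r C : ν) : Finset ν :=
  {S | T.Adj C S ∧ T.dist r S = T.dist r C + 1}

theorem dist_lt_card_of_mem_children {r C S : ν} (h : S ∈ children T r C) :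
    T.dist r C < T.dist r S ∧ T.dist r S < Fintype.card ν := by
  classical
  have h' : T.Adj C S ∧ T.dist r S = T.dist r C + 1 := by simpa [children] using h
  refine ⟨by omega, ?_⟩
  obtain ⟨p, hp⟩ := T.exists_walk_of_dist_ne_zero (u := r) (v := S) (by omega)
  rw [← hp]
  exact (p.isPath_of_length_eq_dist hp).length_lt

open Classical in
/-- Recursion from the leaves to the root of the tree `T` rooted at `r`: the value at a node `C`
is `step C f`, where `f` gives the values at the children of `C`. -/
noncomputable def treeFold {α : Type*} [Inhabited α] (r : ν) (step : ν → (ν → α) → α)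
    (C : ν) : α :=
  step C (fun S => if _h : S ∈ children T r C then treeFold r step S else default)
termination_by Fintype.card ν - T.dist r C
decreasing_by
  have := dist_lt_card_of_mem_children T _h
  omega

/-- `D` belongs to the subtree rooted at `C`, when the tree `T` is rooted at `r`. -/
def InSubtree (r C D : ν) : Prop :=
  Relation.ReflTransGen (fun A B => B ∈ children T r A) C D

end Rooted

/-! ### The recurrence -/

section Recurrence

variable {ν : Type u}

open Classical in
/-- The right-hand sides of the recurrence for the values `Z₀(C, i, j)`, where `ch` is the set of
children of `C` and `Z S i k` are the values at the children `S`; `cyc` says whether `C` is a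
cycle or a singular vertex.  A minimum over the empty set is `⊤`, and so are the
values for the pairs `(i, j)` that do not occur. -/
noncomputable def recurrenceRhs (cyc : Prop) (ch : Finset ν) (Z : ν → Fin 2 → Fin 3 → ℕ∞) :
    Fin 2 → Fin 3 → ℕ∞ :=
  if cyc then fun
    | 0, 0 => 2 + ∑ S ∈ ch, ⨅ k, Z S 1 k
    | 0, 1 => 1 + ⨅ H ∈ ch, ((∑ S ∈ ch.erase H, ⨅ k', Z S 1 k') + ⨅ k, Z H 0 k)
    | 0, 2 => ⨅ H ∈ ch, ⨅ Q ∈ ch.erase H,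
        ((∑ S ∈ (ch.erase H).erase Q, ⨅ k'', Z S 1 k'') + (⨅ k', Z H 0 k') + ⨅ k, Z Q 0 k)
    | 1, 0 => 1 + ∑ S ∈ ch, ⨅ k, Z S 1 k
    | 1, 1 => ⨅ H ∈ ch, ((∑ S ∈ ch.erase H, ⨅ k', Z S 1 k') + ⨅ k, Z H 0 k)
    | 1, 2 => ⊤
  else fun
    | 0, 0 => 1 + ∑ S ∈ ch, ⨅ k, Z S 1 k
    | 0, 1 => ⨅ H ∈ ch, ((∑ S ∈ ch.erase H, ⨅ k', Z S 1 k') + ⨅ k, Z H 0 k)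
    | 1, 0 => ∑ S ∈ ch, ⨅ k, Z S 1 k
    | _, _ => ⊤

theorem recurrenceRhs_congr (cyc : Prop) (ch : Finset ν) (Z Z' : ν → Fin 2 → Fin 3 → ℕ∞)
    (h : ∀ S ∈ ch, Z S = Z' S) : recurrenceRhs cyc ch Z = recurrenceRhs cyc ch Z' := by
  classical
  have key : ∀ (s : Finset ν), s ⊆ ch →
      (∑ S ∈ s, ⨅ k, Z S 1 k) = ∑ S ∈ s, ⨅ k, Z' S 1 k :=
    fun s hs => Finset.sum_congr rfl fun S hS => by rw [h S (hs hS)]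
  have e1 := key ch subset_rfl
  have e2 : (⨅ H ∈ ch, ((∑ S ∈ ch.erase H, ⨅ k', Z S 1 k') + ⨅ k, Z H 0 k)) =
      ⨅ H ∈ ch, ((∑ S ∈ ch.erase H, ⨅ k', Z' S 1 k') + ⨅ k, Z' H 0 k) :=
    iInf_congr fun H => iInf_congr fun hH => by rw [key _ (Finset.erase_subset _ _), h H hH]
  have e3 : (⨅ H ∈ ch, ⨅ Q ∈ ch.erase H,
        ((∑ S ∈ (ch.erase H).erase Q, ⨅ k'', Z S 1 k'') + (⨅ k', Z H 0 k') + ⨅ k, Z Q 0 k)) =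
      ⨅ H ∈ ch, ⨅ Q ∈ ch.erase H,
        ((∑ S ∈ (ch.erase H).erase Q, ⨅ k'', Z' S 1 k'') + (⨅ k', Z' H 0 k') +
          ⨅ k, Z' Q 0 k) :=
    iInf_congr fun H => iInf_congr fun hH => iInf_congr fun Q => iInf_congr fun hQ => by
      rw [key _ ((Finset.erase_subset _ _).trans (Finset.erase_subset _ _)), h H hH,
        h Q (Finset.mem_of_mem_erase hQ)]
  unfold recurrenceRhs
  rw [e1, e2, e3]

variable [Fintype ν] (T : SimpleGraph ν) (isCycle : ν → Prop)

/-- The dynamic-programming values `Z₀(C, i, j)` of the tree `T` rooted at `r`: `i` counts the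
free filled vertices from the parent of `C` and `j` those from its children. -/
noncomputable def dpVal (r : ν) : ν → Fin 2 → Fin 3 → ℕ∞ :=
  treeFold T r (fun C Z => recurrenceRhs (isCycle C) (children T r C) Z)

/-- The values `dpVal` satisfy the recurrence. -/
theorem dpVal_eq (r C : ν) :
    dpVal T isCycle r C = recurrenceRhs (isCycle C) (children T r C) (dpVal T isCycle r) := by
  classical
  conv_lhs => rw [dpVal, treeFold]
  refine recurrenceRhs_congr _ _ _ _ fun S hS => ?_
  simp only [hS, dif_pos]
  rfl

/-! ### Step-counted evaluation of the recurrence -/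

/-- What the evaluation computes at a node `C`: the values `Z₀(C, i, j)`, their minima over `j`,
and the number of steps spent on the subtree rooted at `C`. -/
structure EvalResult where
  val : Fin 2 → Fin 3 → ℕ∞
  dp : Fin 2 → ℕ∞
  ops : ℕ

instance : Inhabited EvalResult := ⟨⟨fun _ _ => 0, fun _ => 0, 0⟩⟩

/-- Running values while the children `S` of a node are scanned: the sum of the
`min_k Z₀(S,1,k)`, and the smallest and second smallest of the differences
`min_k Z₀(S,0,k) - min_k Z₀(S,1,k)`, with the number of steps so far. -/
structure ScanState where
  sum : ℕ∞
  min1 : ℕ∞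
  min2 : ℕ∞
  ops : ℕ

open Classical in
/-- Scan one child: one step for going to the child, one subtraction, one addition, and one or
two comparisons, in addition to the steps that were spent on the subtree of the child. -/
noncomputable def ScanState.push (s : ScanState) (c : EvalResult) : ScanState :=
  let d := c.dp 0 - c.dp 1
  if d < s.min1 then ⟨s.sum + c.dp 1, d, s.min1, s.ops + c.ops + 4⟩
  else if d < s.min2 then ⟨s.sum + c.dp 1, s.min1, d, s.ops + c.ops + 5⟩
  else ⟨s.sum + c.dp 1, s.min1, s.min2, s.ops + c.ops + 5⟩

open Classical in
/-- Evaluate a node from the results at its children: one step for visiting the node,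
5 additions and 3 comparisons for a cycle, 2 additions and 1 comparison for a singular vertex. -/
noncomputable def evalNode (cyc : Prop) (results : List EvalResult) : EvalResult :=
  let s := results.foldl ScanState.push ⟨0, ⊤, ⊤, 0⟩
  if cyc then
    let z01 := s.sum + s.min1
    { val := fun
        | 0, 0 => 2 + s.sum
        | 0, 1 => 1 + z01
        | 0, 2 => z01 + s.min2
        | 1, 0 => 1 + s.sum
        | 1, 1 => z01
        | 1, 2 => ⊤
      dp := fun
        | 0 => min (min (2 + s.sum) (1 + z01)) (z01 + s.min2)
        | 1 => min (1 + s.sum) z01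
      ops := s.ops + 9 }
  else
    let z01 := s.sum + s.min1
    { val := fun
        | 0, 0 => 1 + s.sum
        | 0, 1 => z01
        | 1, 0 => s.sum
        | _, _ => ⊤
      dp := fun
        | 0 => min (1 + s.sum) z01
        | 1 => s.sum
      ops := s.ops + 4 }

/-- The evaluation of the recurrence from the leaves to the root, for the tree rooted at `r`. -/
noncomputable def evalTree (r : ν) : ν → EvalResult :=
  treeFold T r (fun C f => evalNode (isCycle C) ((children T r C).toList.map f))

/-- The total number of steps of the evaluations for all choices of the root, with one comparison
for each root to find the minimum of the results. -/
noncomputable def evalAllOps : ℕ := ∑ r, ((evalTree T isCycle r r).ops + 1)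

end Recurrence

/-- The vertices of `G` in the nodes of the subtree rooted at `C`, when `T` is rooted at `r`. -/
def subtreeVerts {V : Type u} [Finite V] (G : SimpleGraph V) (T : SimpleGraph (CactusNode G))
    (r C : CactusNode G) : Set V :=
  {v | ∃ D, InSubtree T r C D ∧ v ∈ D.1}

/-! ### A machine model: structured programs of a random access machine -/

/-- Expressions; `var i` is the `i`-th register, `load e` the content of the memory cell with
address `e`, `sub` is truncated subtraction. -/
inductive RamExpr
  | lit (n : ℕ)
  | var (i : ℕ)
  | load (e : RamExpr)
  | add (e f : RamExpr)
  | sub (e f : RamExpr)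

/-- Programs; `ite e f c d` runs `c` if `e ≤ f` and `d` otherwise, and `loop e f c` runs `c` as
long as `e ≤ f`. -/
inductive RamProg
  | skip
  | assign (i : ℕ) (e : RamExpr)
  | store (a e : RamExpr)
  | seq (c d : RamProg)
  | ite (e f : RamExpr) (c d : RamProg)
  | loop (e f : RamExpr) (c : RamProg)

/-- The contents of the registers and of the memory. -/
@[ext] structure RamState where
  reg : ℕ → ℕ
  mem : ℕ → ℕ

namespace RamExpr

def eval (s : RamState) : RamExpr → ℕ
  | lit n => n
  | var i => s.reg i
  | load e => s.mem (e.eval s)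
  | add e f => e.eval s + f.eval s
  | sub e f => e.eval s - f.eval s

/-- The number of steps of an evaluation: one for each operation. -/
def cost : RamExpr → ℕ
  | lit _ => 1
  | var _ => 1
  | load e => e.cost + 1
  | add e f => e.cost + f.cost + 1
  | sub e f => e.cost + f.cost + 1

end RamExpr

/-- `RamExec W c s t s'`: started in the state `s`, the program `c` halts after exactly `t` steps
in the state `s'`, and every number that is written, and every address it is written to, is at
most `W` (so that it fits into a word of `O(log W)` bits). -/
inductive RamExec (W : ℕ) : RamProg → RamState → ℕ → RamState → Prop
  | skip (s : RamState) : RamExec W .skip s 1 s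
  | assign (s : RamState) (i : ℕ) (e : RamExpr) : e.eval s ≤ W →
      RamExec W (.assign i e) s (e.cost + 1) ⟨Function.update s.reg i (e.eval s), s.mem⟩
  | store (s : RamState) (a e : RamExpr) : a.eval s ≤ W → e.eval s ≤ W →
      RamExec W (.store a e) s (a.cost + e.cost + 1)
        ⟨s.reg, Function.update s.mem (a.eval s) (e.eval s)⟩
  | seq (c d : RamProg) (s s' s'' : RamState) (t t' : ℕ) :
      RamExec W c s t s' → RamExec W d s' t' s'' → RamExec W (.seq c d) s (t + t') s''
  | iteTrue (e f : RamExpr) (c d : RamProg) (s s' : RamState) (t : ℕ) :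
      e.eval s ≤ f.eval s → RamExec W c s t s' →
      RamExec W (.ite e f c d) s (e.cost + f.cost + 1 + t) s'
  | iteFalse (e f : RamExpr) (c d : RamProg) (s s' : RamState) (t : ℕ) :
      ¬ e.eval s ≤ f.eval s → RamExec W d s t s' →
      RamExec W (.ite e f c d) s (e.cost + f.cost + 1 + t) s'
  | loopTrue (e f : RamExpr) (c : RamProg) (s s' s'' : RamState) (t t' : ℕ) :
      e.eval s ≤ f.eval s → RamExec W c s t s' → RamExec W (.loop e f c) s' t' s'' →
      RamExec W (.loop e f c) s (e.cost + f.cost + 1 + t + t') s''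
  | loopFalse (e f : RamExpr) (c : RamProg) (s : RamState) :
      ¬ e.eval s ≤ f.eval s → RamExec W (.loop e f c) s (e.cost + f.cost + 1) s

open Classical in
/-- The input: `n` in register `0`, and the adjacency matrix of `G` row by row in the cells
`0, …, n² - 1` of the memory; everything else is zero. -/
noncomputable def ramInput (n : ℕ) (G : SimpleGraph (Fin n)) : RamState where
  reg := fun i => if i = 0 then n else 0
  mem := fun a => if ∃ x y : Fin n, a = x.1 * n + y.1 ∧ G.Adj x y then 1 else 0

/-!
All the numbers in the theorem are determined by counting cycles.  For a connected cactus with `c`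
cycles, `Z₊ = Z₀ = c + 1`, and `c` tokens are needed when one vertex is already filled.

*Lower bound* (`finrank_vanishingSpace_le_of_playerWins`).  Label the vertices by distinct reals
`t` and consider the functions on the vertices that are equal at the ends of each bridge and affine
in `t` on each cycle.  In a cactus every cycle `C` has a projection `π` from the graph to `C` that
is constant along the bridges and on the other cycles (`exists_projection`), so the constants and
the functions `t ∘ π` show that this space has dimension at least `c + 1`.  The dimension of the
subspace of functions that vanish on the filled set drops by at most one with each token and, if
the oracle always answers with a single component, it does not drop when the forcing rule is
applied.

*Upper bound* (`psdReach_exists_finset`).  If the positive semidefinite rule does not apply along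
an edge from a filled vertex to an unfilled vertex `v`, this edge is on a cycle whose other vertices
are unfilled, and after a token on `v` the rule fills this whole cycle, since an obstruction would
be a second cycle through one of its edges.  The rule can be simulated by Rule 3 with a
single announced component.

*Recurrence* (`min_dpVal_eq`).  The vertices of the subtree rooted at a node `C` induce a connected
cactus, and its cycles are exactly the cycles among the nodes of the subtree: the projection onto
any other cycle is constant on it (`inSubtree_of_subset_subtreeVerts`).  If the subtree has `a`
cycles, the recurrence gives `min_k Z₀(C,1,k) = a` and `min_k Z₀(C,0,k) = a + 1`, so the
differences formed in the evaluation are all `1`.  A cycle/vertex tree is a spanning tree of the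
graph in which two nodes are adjacent if they share a vertex or are joined by a bridge.

*Complexity*.  There are at most `2n` nodes, and each rooting takes at most `14` steps for each
node.  Deleting one edge of each cycle of a connected cactus with `m` edges leaves a spanning tree,
so `c = m - n + 1` (`ncard_isCycleSet_add_card`), and a program obtains `Z₀ = m - n + 2` by counting
the edges in the adjacency matrix.
-/

namespace Cactus

/-! ### Cycles of a cactus and the projections onto them -/

section Cycles

open SimpleGraph

variable {V : Type u} {G : SimpleGraph V}

/-- A cycle through `x` consists of two edges `xw` and `xz` and a path from `z` to `w` that
avoids `x`. -/
theorem exists_split_of_isCycle {a x : V} {p : G.Walk a a} (hp : p.IsCycle) (hx : x ∈ p.support) :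
    ∃ (w z : V) (r : G.Walk z w), G.Adj x w ∧ G.Adj x z ∧ w ≠ z ∧ r.IsPath ∧ x ∉ r.support ∧
      (∀ e, e ∈ p.edges ↔ e = s(x, w) ∨ e = s(x, z) ∨ e ∈ r.edges) ∧
      ∀ y, y ∈ p.support ↔ y = x ∨ y ∈ r.support := by
  classical
  have hE : ∀ e, e ∈ (p.rotate x hx).edges ↔ e ∈ p.edges :=
    fun e => (p.rotate_edges x hx).mem_iff
  have hS : ∀ y, y ∈ (p.rotate x hx).support ↔ y ∈ p.support :=
    fun y => p.mem_support_rotate_iff x hx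
  have hc : (p.rotate x hx).IsCycle := hp.rotate hx
  generalize p.rotate x hx = c at hE hS hc
  cases c with
  | nil => simp at hc
  | @cons _ w _ h q =>
    rw [Walk.cons_isCycle_iff] at hc
    obtain ⟨hq, hxw⟩ := hc
    have hE' : ∀ e, e ∈ q.reverse.edges ↔ e ∈ q.edges := by simp
    have hS' : ∀ y, y ∈ q.reverse.support ↔ y ∈ q.support := by simp
    have hq' : q.reverse.IsPath := hq.reverse
    generalize q.reverse = q' at hE' hS' hq'
    cases q' with
    | nil => exact absurd h (G.loopless.irrefl _)
    | @cons _ z _ h' r =>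
      rw [Walk.cons_isPath_iff] at hq'
      refine ⟨w, z, r, h, h', ?_, hq'.1, hq'.2, fun e => ?_, fun y => ?_⟩
      · rintro rfl
        exact hxw ((hE' _).1 (by simp))
      · rw [← hE, Walk.edges_cons, List.mem_cons, ← hE', Walk.edges_cons, List.mem_cons]
      · rw [← hS, Walk.support_cons, List.mem_cons, ← hS', Walk.support_cons, List.mem_cons]
        tauto

/-- An edge together with a walk between its ends that avoids it contains a cycle through it. -/
theorem exists_isCycle_of_walk {x w : V} (h : G.Adj x w) (q : G.Walk w x)
    (hq : s(x, w) ∉ q.edges) :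
    ∃ c : G.Walk x x, c.IsCycle ∧ s(x, w) ∈ c.edges ∧ ∀ e ∈ c.edges, e = s(x, w) ∨ e ∈ q.edges := by
  classical
  refine ⟨Walk.cons h q.toPath, Path.cons_isCycle _ _ fun he => hq ?_, by simp, fun e he => ?_⟩
  · exact Walk.edges_toPath_subset_edges q he
  · rw [Walk.edges_cons, List.mem_cons] at he
    exact he.imp_right fun he => Walk.edges_toPath_subset_edges q he

/-- In a cactus, two vertices of a cycle are separated by the removal of its edges: a path
between them outside the cycle would close one of the two arcs to a cycle that shares
some but not all edges with the given one. -/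
theorem eq_of_reachable_deleteEdges (hG : IsCactus G) {a x y : V} {p : G.Walk a a}
    (hp : p.IsCycle) (hx : x ∈ p.support) (hy : y ∈ p.support)
    (h : (G.deleteEdges {e | e ∈ p.edges}).Reachable x y) : x = y := by
  classical
  by_contra hxy
  obtain ⟨w, z, r, hw, hz, hwz, -, hxr, hE, hS⟩ := exists_split_of_isCycle hp hx
  have hyr : y ∈ r.support := ((hS y).1 hy).resolve_left (Ne.symm hxy)
  obtain ⟨d⟩ := h.symm
  have hd : ∀ e ∈ (d.mapLe (deleteEdges_le _)).edges, e ∉ p.edges := by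
    intro e he
    rw [Walk.edges_mapLe_eq_edges] at he
    have := d.edges_subset_edgeSet he
    rw [edgeSet_deleteEdges] at this
    exact this.2
  have hr : ∀ e ∈ (r.dropUntil y hyr).reverse.edges, x ∉ e := by
    intro e he hxe
    rw [Walk.edges_reverse, List.mem_reverse] at he
    have he' := r.edges_dropUntil_subset_edges hyr he
    exact hxr (Walk.mem_support_of_mem_edges he' hxe)
  -- this cycle goes from `x` along `xw` and the cycle `p` to `y` and returns outside `p`, so it
  -- contains `xw` but not `xz`
  obtain ⟨c, hc, hxc, hcE⟩ := exists_isCycle_of_walk hw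
    ((r.dropUntil y hyr).reverse.append (d.mapLe (deleteEdges_le _))) (by
      rw [Walk.edges_append, List.mem_append]
      rintro (he | he)
      · exact hr _ he (by simp)
      · exact hd _ he ((hE _).2 (Or.inl rfl)))
  have hxz : s(x, z) ∈ c.edges :=
    (hG p c hp hc _ ((hE _).2 (Or.inl rfl)) hxc _).1 ((hE _).2 (Or.inr (Or.inl rfl)))
  rcases hcE _ hxz with he | he
  · rw [Sym2.congr_right] at he
    exact hwz he.symm
  · rw [Walk.edges_append, List.mem_append] at he
    rcases he with he | he
    · exact hr _ he (by simp)
    · exact hd _ he ((hE _).2 (Or.inr (Or.inl rfl)))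

theorem eq_of_walk_of_edges {α : Type*} (f : V → α) {s : Set (Sym2 V)}
    (hf : ∀ v w, G.Adj v w → s(v, w) ∉ s → f v = f w) {x y : V} (q : G.Walk x y)
    (hq : ∀ e ∈ q.edges, e ∉ s) {z : V} (hz : z ∈ q.support) : f z = f x := by
  induction q with
  | nil => rw [Walk.support_nil, List.mem_singleton] at hz; rw [hz]
  | @cons x x' y h q ih =>
    rw [Walk.support_cons, List.mem_cons] at hz
    rcases hz with rfl | hz
    · rfl
    · rw [ih (fun e he => hq e (by simp [he])) hz]
      exact (hf _ _ h (hq _ (by simp))).symm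

/-- A vertex is sent to the vertex of the cycle that it is joined to outside the cycle; vertices in
other components are all sent to one arbitrary vertex. -/
theorem exists_projection_walk (hG : IsCactus G) {a : V} {p : G.Walk a a} (hp : p.IsCycle) :
    ∃ π : V → V, (∀ v ∈ p.support, π v = v) ∧
      ∀ v w, G.Adj v w → s(v, w) ∉ p.edges → π v = π w := by
  let R := (G.deleteEdges {e | e ∈ p.edges}).Reachable
  have : Nonempty V := ⟨a⟩
  refine ⟨fun v => Classical.epsilon fun c => c ∈ p.support ∧ R v c, fun v hv => ?_,
    fun v w hvw he => ?_⟩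
  · have h := Classical.epsilon_spec (p := fun c => c ∈ p.support ∧ R v c) ⟨v, hv, .refl _⟩
    exact (eq_of_reachable_deleteEdges hG hp hv h.1 h.2).symm
  · have hR : R v w := Adj.reachable (by simpa [hvw] using he)
    have : (fun c => c ∈ p.support ∧ R v c) = fun c => c ∈ p.support ∧ R w c := by
      funext c
      exact propext (and_congr_right fun _ => ⟨fun h => hR.symm.trans h, fun h => hR.trans h⟩)
    simp only [this]

theorem exists_ne_mem_support_of_isCycle {a : V} {p : G.Walk a a} (hp : p.IsCycle) (x : V) :
    ∃ y ∈ p.support, y ≠ x := by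
  obtain ⟨w, z, r, hw, -, -, -, -, -, hS⟩ := exists_split_of_isCycle hp p.start_mem_support
  by_cases h : a = x
  · exact ⟨w, (hS w).2 (Or.inr r.end_mem_support), h ▸ hw.ne'⟩
  · exact ⟨a, p.start_mem_support, h⟩

theorem mem_support_iff_of_mem_edges (hG : IsCactus G) {a b : V} {p : G.Walk a a}
    {q : G.Walk b b} (hp : p.IsCycle) (hq : q.IsCycle) {e : Sym2 V} (hep : e ∈ p.edges)
    (heq : e ∈ q.edges) (v : V) : v ∈ p.support ↔ v ∈ q.support := by
  simp only [Walk.mem_support_iff_exists_mem_edges_of_not_nil hp.not_nil,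
    Walk.mem_support_iff_exists_mem_edges_of_not_nil hq.not_nil, hG p q hp hq e hep heq]

/-- In a cactus, a cycle is determined by its vertices. -/
theorem mem_edges_iff_of_support_eq (hG : IsCactus G) {a b : V} {p : G.Walk a a} {q : G.Walk b b}
    (hp : p.IsCycle) (hq : q.IsCycle) (h : ∀ v, v ∈ p.support ↔ v ∈ q.support) (e : Sym2 V) :
    e ∈ p.edges ↔ e ∈ q.edges := by
  by_contra hne
  obtain ⟨π, hπ, hπe⟩ := exists_projection_walk hG hp
  have hdis : ∀ e ∈ q.edges, e ∉ {e | e ∈ p.edges} := fun e' he' he =>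
    hne (hG p q hp hq e' he he' e)
  have hc := fun z hz => eq_of_walk_of_edges π hπe q hdis (z := z) hz
  obtain ⟨y, hy, hyb⟩ := exists_ne_mem_support_of_isCycle hq b
  rw [← hπ y ((h y).2 hy), ← hπ b ((h b).2 q.start_mem_support)] at hyb
  exact hyb (hc y hy)

/-- The projection onto a cycle of a cactus: it fixes the vertices of the cycle, and it is
constant along the bridges and on the other cycles. -/
theorem exists_projection (hG : IsCactus G) {s : Set V} (hs : IsCycleSet G s) :
    ∃ π : V → V, (∀ v ∈ s, π v = v) ∧
      (∀ v w, G.Adj v w → G.IsBridge s(v, w) → π v = π w) ∧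
      ∀ t, IsCycleSet G t → t ≠ s → ∀ v ∈ t, ∀ w ∈ t, π v = π w := by
  obtain ⟨a, p, hp, rfl⟩ := hs
  obtain ⟨π, hπ, hπe⟩ := exists_projection_walk hG hp
  refine ⟨π, hπ, fun v w h hb => hπe v w h (hb.notMem_edges_of_isCycle hp), ?_⟩
  rintro _ ⟨b, q, hq, rfl⟩ hne v hv w hw
  have hdis : ∀ e ∈ q.edges, e ∉ {e | e ∈ p.edges} := by
    intro e he he'
    exact hne (Set.ext fun v => (mem_support_iff_of_mem_edges hG hp hq he' he v).symm)
  rw [eq_of_walk_of_edges π hπe q hdis hv, eq_of_walk_of_edges π hπe q hdis hw]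

theorem IsCycleSet.exists_ne {s : Set V} (hs : IsCycleSet G s) (x : V) : ∃ y ∈ s, y ≠ x := by
  obtain ⟨a, p, hp, rfl⟩ := hs
  exact exists_ne_mem_support_of_isCycle hp x

theorem IsCycleSet.nonempty {s : Set V} (hs : IsCycleSet G s) : s.Nonempty := by
  obtain ⟨a, p, hp, rfl⟩ := hs
  exact ⟨a, p.start_mem_support⟩

/-- An edge that is not a bridge belongs to a cycle `s`; the other neighbour `w` of `x` on `s`
is joined to `v` inside `s` without `x`. -/
theorem isBridge_or_exists_isCycleSet {x v : V} (h : G.Adj x v) :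
    G.IsBridge s(x, v) ∨ ∃ s, IsCycleSet G s ∧ x ∈ s ∧ v ∈ s ∧ ∃ w ∈ s, w ≠ v ∧ G.Adj x w ∧
      ∃ r : G.Walk v w, ∀ y ∈ r.support, y ∈ s ∧ y ≠ x := by
  by_cases hb : G.IsBridge s(x, v)
  · exact Or.inl hb
  rw [isBridge_iff_forall_cycle_notMem h] at hb
  push Not at hb
  obtain ⟨a, p, hp, he⟩ := hb
  obtain ⟨w, z, r, hw, hz, hwz, -, hxr, hE, hS⟩ :=
    exists_split_of_isCycle hp (p.fst_mem_support_of_mem_edges he)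
  have hr : ∀ y ∈ r.support, y ∈ {y | y ∈ p.support} ∧ y ≠ x := fun y hy =>
    ⟨(hS y).2 (Or.inr hy), fun h => hxr (h ▸ hy)⟩
  refine Or.inr ⟨_, ⟨a, p, hp, rfl⟩, p.fst_mem_support_of_mem_edges he,
    p.snd_mem_support_of_mem_edges he, ?_⟩
  rcases (hE _).1 he with he | he | he
  · rw [Sym2.congr_right] at he
    subst he
    exact ⟨z, (hr z r.start_mem_support).1, hwz.symm, hz, r.reverse,
      fun y hy => hr y (by simpa using hy)⟩
  · rw [Sym2.congr_right] at he
    subst he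
    exact ⟨w, (hr w r.end_mem_support).1, hwz, hw, r, hr⟩
  · exact absurd (r.fst_mem_support_of_mem_edges he) hxr

end Cycles

/-! ### The lower bound: a space of functions that are affine on the cycles -/

section LowerBound

open SimpleGraph

variable {V : Type u} {G : SimpleGraph V}

/-- The functions on the vertices that take equal values at the ends of each bridge and, on each
cycle, are affine functions of the labels `t`.  When `t` is injective, such a function vanishes
on a cycle as soon as it vanishes at two of its vertices. -/
def affineSpace (G : SimpleGraph V) (t : V → ℝ) : Submodule ℝ (V → ℝ) where
  carrier := {y | (∀ v w, G.Adj v w → G.IsBridge s(v, w) → y v = y w) ∧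
    ∀ s, IsCycleSet G s → ∃ a b : ℝ, ∀ v ∈ s, y v = a + b * t v}
  zero_mem' := ⟨fun _ _ _ _ => rfl, fun _ _ => ⟨0, 0, fun _ _ => by simp⟩⟩
  add_mem' := by
    rintro y z ⟨hy, hy'⟩ ⟨hz, hz'⟩
    refine ⟨fun v w h hb => by
      simp only [Pi.add_apply, hy v w h hb, hz v w h hb], fun s hs => ?_⟩
    obtain ⟨a, b, h⟩ := hy' s hs
    obtain ⟨a', b', h'⟩ := hz' s hs
    exact ⟨a + a', b + b', fun v hv => by rw [Pi.add_apply, h v hv, h' v hv]; ring⟩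
  smul_mem' := by
    rintro c y ⟨hy, hy'⟩
    refine ⟨fun v w h hb => by
      simp only [Pi.smul_apply, hy v w h hb], fun s hs => ?_⟩
    obtain ⟨a, b, h⟩ := hy' s hs
    exact ⟨c * a, c * b, fun v hv => by rw [Pi.smul_apply, h v hv, smul_eq_mul]; ring⟩

/-- The functions in `affineSpace G t` that vanish on `F`.  Their dimension bounds the number of
tokens that are still needed when `F` is filled. -/
def vanishingSpace (G : SimpleGraph V) (t : V → ℝ) (F : Set V) : Submodule ℝ (V → ℝ) where
  carrier := {y | y ∈ affineSpace G t ∧ ∀ v ∈ F, y v = 0}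
  zero_mem' := ⟨zero_mem _, fun _ _ => rfl⟩
  add_mem' := fun hy hz => ⟨add_mem hy.1 hz.1, fun v hv => by simp [hy.2 v hv, hz.2 v hv]⟩
  smul_mem' := fun c y hy => ⟨Submodule.smul_mem _ c hy.1, fun v hv => by simp [hy.2 v hv]⟩

theorem vanishingSpace_empty (t : V → ℝ) : vanishingSpace G t ∅ = affineSpace G t :=
  Submodule.ext fun _ => ⟨fun h => h.1, fun h => ⟨h, fun _ hv => hv.elim⟩⟩

theorem finrank_vanishingSpace_le_insert [Finite V] (t : V → ℝ) (F : Set V) (v : V) :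
    Module.finrank ℝ (vanishingSpace G t F) ≤
      Module.finrank ℝ (vanishingSpace G t (insert v F)) + 1 := by
  let f := (LinearMap.proj (R := ℝ) (φ := fun _ : V => ℝ) v).domRestrict (vanishingSpace G t F)
  have h := LinearMap.finrank_range_add_finrank_ker f
  have h1 : Module.finrank ℝ (LinearMap.range f) ≤ 1 := by
    simpa using Submodule.finrank_le (LinearMap.range f)
  have h2 : (LinearMap.ker f).map (vanishingSpace G t F).subtype =
      vanishingSpace G t (insert v F) := by
    ext y
    constructor
    · rintro ⟨⟨y, hy⟩, hv, rfl⟩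
      refine ⟨hy.1, ?_⟩
      rintro w (rfl | hw)
      · exact hv
      · exact hy.2 w hw
    · intro hy
      exact ⟨⟨y, hy.1, fun w hw => hy.2 w (Or.inr hw)⟩, hy.2 v (Or.inl rfl), rfl⟩
  rw [← h2, Submodule.finrank_map_subtype_eq]
  omega

/-- If `v` is the only neighbour of the filled vertex `x` in its component of unfilled vertices,
then the functions that vanish on the filled vertices vanish at `v`: either `xv` is a bridge, or
the cycle through `xv` has a filled vertex other than `x`. -/
theorem apply_eq_zero_of_force {t : V → ℝ} (ht : t.Injective) {F : Set V} {x v : V} (hx : x ∈ F)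
    (hxv : G.Adj x v)
    (h : ∀ w, G.Adj x w → w ≠ v → ∀ r : G.Walk v w, ∃ z ∈ r.support, z ∈ F)
    {y : V → ℝ} (hy : y ∈ vanishingSpace G t F) : y v = 0 := by
  rcases isBridge_or_exists_isCycleSet hxv with hb | ⟨s, hs, hxs, hvs, w, -, hwv, hxw, r, hr⟩
  · rw [← hy.1.1 x v hxv hb, hy.2 x hx]
  · obtain ⟨z, hz, hzF⟩ := h w hxw hwv r
    obtain ⟨a, b, hab⟩ := hy.1.2 s hs
    have h1 := hab x hxs
    have h2 := hab z (hr z hz).1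
    rw [hy.2 x hx] at h1
    rw [hy.2 z hzF] at h2
    have h3 : b * (t x - t z) = 0 := by linear_combination h2 - h1
    have hb : b = 0 := (mul_eq_zero.1 h3).resolve_right
      (sub_ne_zero.2 fun e => (hr z hz).2 (ht e).symm)
    rw [hab v hvs]
    rw [hb] at h1 ⊢
    linarith

/-- Against the oracle that always picks a single component, each token decreases the dimension of
`vanishingSpace G t F` by at most one, and the forcing rule does not change it. -/
theorem finrank_vanishingSpace_le_of_playerWins [Finite V] {t : V → ℝ} (ht : t.Injective) {k : ℕ}
    {F : Set V} (h : PlayerWins G 0 k F) : Module.finrank ℝ (vanishingSpace G t F) ≤ k := by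
  have insert_le : ∀ (F : Set V) (x v : V), x ∈ F → G.Adj x v →
      (∀ w, G.Adj x w → w ≠ v → ∀ r : G.Walk v w, ∃ z ∈ r.support, z ∈ F) →
      Module.finrank ℝ (vanishingSpace G t F) ≤
        Module.finrank ℝ (vanishingSpace G t (insert v F)) := by
    intro F x v hx hxv h
    refine Submodule.finrank_mono fun y hy => ⟨hy.1, ?_⟩
    rintro w (rfl | hw)
    · exact apply_eq_zero_of_force ht hx hxv h hy
    · exact hy.2 w hw
  induction h with
  | done k =>
    have : vanishingSpace G t Set.univ = ⊥ :=
      (Submodule.eq_bot_iff _).2 fun y hy => funext fun v => hy.2 v trivial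
    rw [this, finrank_bot]
    exact Nat.zero_le _
  | token k F v _ ih => exact (finrank_vanishingSpace_le_insert t F v).trans (by omega)
  | force k F x v hf _ ih =>
    refine (insert_le F x v hf.1 hf.2.2.1 fun w hxw hwv r => ?_).trans ih
    by_contra hw
    push Not at hw
    exact hwv (hf.2.2.2 w (hw w r.end_mem_support) hxw)
  | oracle k F A next hA hnext _ ih =>
    have hne : A.Nonempty := by
      rw [← Set.one_le_encard_iff_nonempty]
      simpa using hA
    obtain ⟨U, hU⟩ := hne
    -- the oracle answers with the single component `U`
    have hUA : {U} ⊆ A := Set.singleton_subset_iff.2 hU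
    have ih := ih {U} hUA (Set.singleton_nonempty U)
    rcases hnext {U} hUA (Set.singleton_nonempty U) with hF | ⟨x, v, hf, hF⟩
    · rwa [hF] at ih
    · rw [hF] at ih
      refine (insert_le F x v hf.1 hf.2.2.1 fun w hxw hwv r => ?_).trans ih
      by_contra hw
      push Not at hw
      obtain ⟨hv, hvU⟩ := hf.2.1
      have hwF : w ∈ Fᶜ := hw w r.end_mem_support
      refine hwv (hf.2.2.2 w ⟨hwF, ?_⟩ hxw)
      rw [Set.mem_singleton_iff] at hvU ⊢
      rw [← hvU]
      exact (ConnectedComponent.sound (r.induce Fᶜ hw).reachable).symm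

/-- The constant functions and, for each cycle, the labels of the projections onto it are linearly
independent elements of `affineSpace G t`. -/
theorem add_one_le_finrank_affineSpace [Finite V] [Nonempty V] (hG : IsCactus G) {t : V → ℝ}
    (ht : t.Injective) :
    {s | IsCycleSet G s}.ncard + 1 ≤ Module.finrank ℝ (affineSpace G t) := by
  classical
  have := Fintype.ofFinite {s // IsCycleSet G s}
  choose π hπ hπb hπc using fun s : {s // IsCycleSet G s} => exists_projection hG s.2
  let f : (ℝ × ({s // IsCycleSet G s} → ℝ)) →ₗ[ℝ] (V → ℝ) :=
    { toFun := fun c v => c.1 + ∑ s, c.2 s * t (π s v)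
      map_add' := fun c d => by
        funext v
        simp only [Prod.fst_add, Prod.snd_add, Pi.add_apply, add_mul, Finset.sum_add_distrib]
        ring
      map_smul' := fun a c => by
        funext v
        simp only [Prod.smul_fst, Prod.smul_snd, Pi.smul_apply, smul_eq_mul, RingHom.id_apply,
          mul_add, Finset.mul_sum, mul_assoc] }
  -- on the cycle `s` only the summand of `s` itself varies
  have hsub : ∀ (c : ℝ × ({s // IsCycleSet G s} → ℝ)) (s : {s // IsCycleSet G s}), ∀ v ∈ s.1,
      ∀ w ∈ s.1, f c v - f c w = c.2 s * (t v - t w) := by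
    intro c s v hv w hw
    have : f c v - f c w = ∑ s, c.2 s * (t (π s v) - t (π s w)) := by
      simp only [f, LinearMap.coe_mk, AddHom.coe_mk, mul_sub, Finset.sum_sub_distrib]
      ring
    rw [this, Finset.sum_eq_single s]
    · rw [hπ s v hv, hπ s w hw]
    · intro s' _ hs'
      rw [hπc s' s.1 s.2 (fun h => hs' (Subtype.ext h.symm)) v hv w hw, sub_self, mul_zero]
    · simp
  have hmem : ∀ c, f c ∈ affineSpace G t := by
    refine fun c => ⟨fun v w h hb => ?_, fun s hs => ?_⟩
    · simp only [f, LinearMap.coe_mk, AddHom.coe_mk]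
      congr 1
      exact Finset.sum_congr rfl fun s _ => by rw [hπb s v w h hb]
    · obtain ⟨w, hw⟩ := IsCycleSet.nonempty hs
      refine ⟨f c w - c.2 ⟨s, hs⟩ * t w, c.2 ⟨s, hs⟩, fun v hv => ?_⟩
      linear_combination hsub c ⟨s, hs⟩ v hv w hw
  have hinj : Function.Injective (f.codRestrict _ hmem) := by
    rw [← LinearMap.ker_eq_bot, LinearMap.ker_codRestrict, LinearMap.ker_eq_bot']
    intro c hc
    have h2 : c.2 = 0 := by
      funext s
      obtain ⟨v, hv⟩ := IsCycleSet.nonempty s.2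
      obtain ⟨w, hw, hwv⟩ := IsCycleSet.exists_ne s.2 v
      have := hsub c s v hv w hw
      rw [hc, Pi.zero_apply, Pi.zero_apply, sub_self] at this
      exact (mul_eq_zero.1 this.symm).resolve_right (sub_ne_zero.2 fun e => hwv (ht e).symm)
    have h1 := congrFun hc (Classical.arbitrary V)
    simp only [f, LinearMap.coe_mk, AddHom.coe_mk, h2, Pi.zero_apply, zero_mul,
      Finset.sum_const_zero, add_zero] at h1
    exact Prod.ext h1 h2
  have := LinearMap.finrank_le_finrank_of_injective hinj
  rw [Module.finrank_prod, Module.finrank_self, Module.finrank_pi, ← Nat.card_eq_fintype_card,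
    add_comm] at this
  exact this

theorem exists_injective_real [Finite V] : ∃ t : V → ℝ, t.Injective := by
  obtain ⟨n, ⟨e⟩⟩ := Finite.exists_equiv_fin V
  exact ⟨fun v => ((e v : ℕ) : ℝ), fun v w h => e.injective (Fin.ext (by simpa using h))⟩

theorem ncard_add_one_le_of_playerWins_empty [Finite V] [Nonempty V] (hG : IsCactus G) {k : ℕ}
    (h : PlayerWins G 0 k ∅) : {s | IsCycleSet G s}.ncard + 1 ≤ k := by
  obtain ⟨t, ht⟩ := exists_injective_real (V := V)
  have := finrank_vanishingSpace_le_of_playerWins ht h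
  rw [vanishingSpace_empty] at this
  exact (add_one_le_finrank_affineSpace hG ht).trans this

theorem ncard_le_of_playerWins_singleton [Finite V] (hG : IsCactus G) {k : ℕ} {v : V}
    (h : PlayerWins G 0 k {v}) : {s | IsCycleSet G s}.ncard ≤ k := by
  have : Nonempty V := ⟨v⟩
  -- from the empty set, a token on `v` leads to `{v}`
  exact Nat.succ_le_succ_iff.1
    (ncard_add_one_le_of_playerWins_empty hG (.token k ∅ v (by rwa [insert_empty_eq])))

end LowerBound

/-! ### The upper bound: one token fills one more cycle -/

section UpperBound

open SimpleGraph

variable {V : Type u} {G : SimpleGraph V}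

theorem exists_walk_of_walk_induce {s : Set V} {a b : s} (r : (G.induce s).Walk a b) :
    ∃ q : G.Walk a b, ∀ z ∈ q.support, z ∈ s := by
  induction r with
  | nil => exact ⟨.nil, by simp⟩
  | @cons a b c h r ih =>
    obtain ⟨q, hq⟩ := ih
    refine ⟨.cons (induce_adj.1 h) q, fun z hz => ?_⟩
    rw [Walk.support_cons, List.mem_cons] at hz
    rcases hz with rfl | hz
    · exact a.2
    · exact hq z hz

theorem psdReach_trans {F F' F'' : Set V} (h : PSDReach G F F') (h' : PSDReach G F' F'') :
    PSDReach G F F'' := by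
  induction h with
  | refl => exact h'
  | step F F' x v hv hx hxv hw _ ih => exact .step F F'' x v hv hx hxv hw (ih h')

theorem psdReach_subset {F F' : Set V} (h : PSDReach G F F') : F ⊆ F' := by
  induction h with
  | refl => exact subset_rfl
  | step F F' x v hv hx hxv hw _ ih => exact (Set.subset_insert _ _).trans ih

theorem psdReach_of_walk {F F' : Set V} {x v : V} (hv : v ∉ F) (hx : x ∈ F) (hxv : G.Adj x v)
    (h : ∀ w, G.Adj x w → w ≠ v → ∀ r : G.Walk w v, ∃ z ∈ r.support, z ∈ F)
    (hF : PSDReach G (insert v F) F') : PSDReach G F F' := by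
  refine .step F F' x v hv hx hxv (fun w hw hxw hwv => ?_) hF
  rintro ⟨r⟩
  obtain ⟨q, hq⟩ := exists_walk_of_walk_induce r
  obtain ⟨z, hz, hzF⟩ := h w hxw hwv q
  exact hq z hz hzF

/-- Filled vertices never hinder the rule. -/
theorem psdReach_union {F F' : Set V} (h : PSDReach G F F') (S : Set V) :
    PSDReach G (F ∪ S) (F' ∪ S) := by
  induction h with
  | refl => exact .refl _
  | step F F' x v hv hx hxv hw _ ih =>
    rw [Set.insert_union] at ih
    by_cases hvS : v ∈ F ∪ S
    · rwa [Set.insert_eq_of_mem hvS] at ih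
    · refine psdReach_of_walk hvS (Or.inl hx) hxv (fun w hxw hwv r => ?_) ih
      by_contra hr
      push Not at hr
      have hr' : ∀ z ∈ r.support, z ∈ Fᶜ := fun z hz hzF => hr z hz (Or.inl hzF)
      exact hw w (hr' w r.start_mem_support) hxw hwv (r.induce Fᶜ hr').reachable

/-- The positive semidefinite rule is Rule 3 for `q = 0` with a single announced component, to
which the oracle has only one answer. -/
theorem playerWins_of_psdReach {F F' : Set V} (h : PSDReach G F F') {k : ℕ}
    (hk : PlayerWins G 0 k F') : PlayerWins G 0 k F := by
  induction h with
  | refl => exact hk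
  | step F F' x v hv hx hxv hw _ ih =>
    refine .oracle k F {(G.induce Fᶜ).connectedComponentMk ⟨v, hv⟩} (fun _ => insert v F)
      (by simp) (fun W hW hne => Or.inr ⟨x, v, ⟨hx, ?_, hxv, ?_⟩, rfl⟩) (fun _ _ _ => ih hk)
    · rw [hne.subset_singleton_iff.1 hW]
      exact ⟨hv, rfl⟩
    · rintro w ⟨hw', hwW⟩ hxw
      by_contra hne'
      exact hw w hw' hxw hne' (ConnectedComponent.exact (hW hwW))

theorem playerWins_of_union {q k : ℕ} (F : Set V) (S : Finset V)
    (h : PlayerWins G q k (F ∪ S)) : PlayerWins G q (k + S.card) F := by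
  classical
  induction S using Finset.induction_on generalizing F with
  | empty => simpa using h
  | insert v S hv ih =>
    rw [Finset.card_insert_of_notMem hv, ← add_assoc]
    refine .token _ F v (ih _ ?_)
    rwa [Finset.coe_insert, Set.union_insert, ← Set.insert_union] at h

/-- If `x` and one end of a walk along a cycle `c` that avoids `x` are filled, where `x` is on
`c`, then the walk gets filled: an obstruction to a step along the path would be a cycle that shares an edge with `c`
but avoids `x`. -/
theorem psdReach_exists_of_walk (hG : IsCactus G) {a x : V} {c : G.Walk a a} (hc : c.IsCycle)
    (hxc : x ∈ c.support) {b d : V} (q : G.Walk b d) (hq : ∀ e ∈ q.edges, e ∈ c.edges)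
    (hxq : x ∉ q.support) {F : Set V} (hx : x ∈ F) (hb : b ∈ F) :
    ∃ F', PSDReach G F F' ∧ ∀ y ∈ q.support, y ∈ F' := by
  induction q generalizing F with
  | nil => exact ⟨F, .refl F, by simpa using hb⟩
  | @cons b b' d h q ih =>
    rw [Walk.support_cons, List.mem_cons, not_or] at hxq
    obtain ⟨F', hF', hqF'⟩ := ih (fun e he => hq e (by simp [he])) hxq.2
      (F := insert b' F) (Or.inr hx) (Or.inl rfl)
    have hall : ∀ y ∈ (Walk.cons h q).support, y ∈ F' := by
      intro y hy
      rw [Walk.support_cons, List.mem_cons] at hy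
      rcases hy with rfl | hy
      · exact psdReach_subset hF' (Or.inr hb)
      · exact hqF' y hy
    refine ⟨F', ?_, hall⟩
    by_cases hb' : b' ∈ F
    · rwa [Set.insert_eq_of_mem hb'] at hF'
    refine psdReach_of_walk hb' hb h (fun w hbw hwb' r => ?_) hF'
    by_contra hr
    push Not at hr
    have hbr : b ∉ r.support := fun hbr => hr b hbr hb
    -- the second cycle consists of the edge `bb'`, the path `r` of unfilled vertices and `wb`
    obtain ⟨c', hc', he, hE⟩ := exists_isCycle_of_walk h (r.reverse.append (.cons hbw.symm .nil))
      (by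
        rw [Walk.edges_append, Walk.edges_reverse, List.mem_append, List.mem_reverse]
        rintro (he | he)
        · exact hbr (r.fst_mem_support_of_mem_edges he)
        · rw [Walk.edges_cons, Walk.edges_nil, List.mem_singleton, Sym2.eq_swap,
            Sym2.congr_left] at he
          exact hwb' he.symm)
    have hxc' : x ∉ c'.support := by
      rw [Walk.mem_support_iff_exists_mem_edges_of_not_nil hc'.not_nil]
      rintro ⟨e, he, hxe⟩
      have hxr : x ∉ r.support := fun hxr => hr x hxr hx
      rcases hE e he with rfl | he
      · rcases Sym2.mem_iff.1 hxe with rfl | rfl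
        · exact hxq.1 rfl
        · exact hb' hx
      · rw [Walk.edges_append, Walk.edges_reverse, List.mem_append, List.mem_reverse] at he
        rcases he with he | he
        · exact hxr (Walk.mem_support_of_mem_edges he hxe)
        · rw [Walk.edges_cons, Walk.edges_nil, List.mem_singleton] at he
          subst he
          rcases Sym2.mem_iff.1 hxe with rfl | rfl
          · exact hxr r.start_mem_support
          · exact hxq.1 rfl
    rw [Walk.mem_support_iff_exists_mem_edges_of_not_nil hc.not_nil] at hxc
    obtain ⟨e, hec, hxe⟩ := hxc
    have := (hG c c' hc hc' _ (hq _ (by simp)) he e).1 hec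
    exact hxc' (Walk.mem_support_of_mem_edges this hxe)

/-- If the rule does not apply along the edge `xv`, then `x` and `v` lie on a cycle, and filling
`v` with a token makes the rule fill the whole cycle. -/
theorem psdReach_exists_insert (hG : IsCactus G) {F : Set V} {x v w : V} (hx : x ∈ F)
    (hxv : G.Adj x v) (hxw : G.Adj x w) (hwv : w ≠ v) (r : G.Walk v w)
    (hr : ∀ z ∈ r.support, z ∉ F) :
    ∃ F' s, PSDReach G (insert v F) F' ∧ IsCycleSet G s ∧ s ⊆ F' ∧ v ∈ s := by
  classical
  have hxr : x ∉ r.bypass.support := fun h => hr x (r.support_bypass_subset_support h) hx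
  have hcyc : (Walk.cons hxv (r.bypass.concat hxw.symm)).IsCycle := by
    rw [Walk.cons_isCycle_iff]
    refine ⟨(r.bypass_isPath).concat hxr hxw.symm, ?_⟩
    rw [Walk.edges_concat, List.concat_eq_append, List.mem_append]
    rintro (he | he)
    · exact hxr (Walk.fst_mem_support_of_mem_edges _ he)
    · rw [List.mem_singleton, Sym2.eq_swap, Sym2.congr_left] at he
      exact hwv he.symm
  obtain ⟨F', hF', hs⟩ := psdReach_exists_of_walk hG hcyc (Walk.start_mem_support _) r.bypass
    (fun e he => by simp [Walk.edges_concat, he]) hxr (F := insert v F) (Or.inr hx) (Or.inl rfl)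
  refine ⟨F', _, hF', ⟨x, _, hcyc, rfl⟩, fun y hy => ?_, ?_⟩
  · simp only [Set.mem_ofPred_eq, Walk.support_cons, Walk.support_concat,
      List.mem_cons, List.mem_append, List.not_mem_nil, or_false] at hy
    rcases hy with rfl | hy | rfl
    · exact psdReach_subset hF' (Or.inr hx)
    · exact hs y hy
    · exact psdReach_subset hF' (Or.inr hx)
  · simp [Walk.support_concat]

theorem exists_adj_notMem_of_connected (hG : G.Connected) {F : Set V} (hne : F.Nonempty)
    (hF : F ≠ Set.univ) : ∃ x ∈ F, ∃ v ∉ F, G.Adj x v := by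
  obtain ⟨x, hx⟩ := hne
  obtain ⟨v, hv⟩ := (Set.ne_univ_iff_exists_notMem F).1 hF
  obtain ⟨q⟩ := hG.preconnected x v
  obtain ⟨d, -, hd, hd'⟩ := q.exists_boundary_dart F hx hv
  exact ⟨d.fst, hd, d.snd, hd', d.adj⟩

/-- In a connected cactus, a nonempty filled set needs at most one additional token for each
cycle that is not contained in it. -/
theorem psdReach_exists_finset [Finite V] (hconn : G.Connected) (hG : IsCactus G) (F : Set V)
    (hne : F.Nonempty) :
    ∃ S : Finset V, S.card ≤ {s | IsCycleSet G s ∧ ¬ s ⊆ F}.ncard ∧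
      PSDReach G (F ∪ S) Set.univ := by
  classical
  induction hn : Fᶜ.ncard using Nat.strong_induction_on generalizing F with
  | _ n ih =>
  subst hn
  by_cases hF : F = Set.univ
  · subst hF
    exact ⟨∅, by simp, by simpa using PSDReach.refl _⟩
  obtain ⟨x, hx, v, hv, hxv⟩ := exists_adj_notMem_of_connected hconn hne hF
  have hlt : ∀ F' : Set V, insert v F ⊆ F' → F'ᶜ.ncard < Fᶜ.ncard := fun F' h =>
    Set.ncard_lt_ncard (compl_lt_compl_iff_lt.2 ((Set.ssubset_insert hv).trans_subset h))
  by_cases hforce : ∀ w, G.Adj x w → w ≠ v → ∀ r : G.Walk w v, ∃ z ∈ r.support, z ∈ F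
  · obtain ⟨S, hS, hSF⟩ := ih _ (hlt _ subset_rfl) _ (Set.insert_nonempty _ _) rfl
    refine ⟨S, hS.trans (Set.ncard_le_ncard fun s hs => ⟨hs.1, fun h => hs.2 ?_⟩), ?_⟩
    · exact h.trans (Set.subset_insert _ _)
    · exact psdReach_trans (psdReach_union (psdReach_of_walk hv hx hxv hforce (.refl _)) _) hSF
  · push Not at hforce
    obtain ⟨w, hxw, hwv, r, hr⟩ := hforce
    obtain ⟨F', s, hF', hs, hsF', hvs⟩ := psdReach_exists_insert hG hx hxv hxw hwv r.reverse
      (fun z hz => hr z (by simpa using hz))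
    have hsub := psdReach_subset hF'
    obtain ⟨S, hS, hSF⟩ := ih _ (hlt _ hsub) _ ((Set.insert_nonempty v F).mono hsub) rfl
    refine ⟨insert v S, (Finset.card_insert_le _ _).trans ?_, ?_⟩
    · refine (Nat.succ_le_succ hS).trans (Nat.succ_le_of_lt (Set.ncard_lt_ncard ?_))
      refine Set.ssubset_iff_exists.2 ⟨fun t ht => ⟨ht.1, fun h => ht.2 ?_⟩,
        s, ⟨hs, fun h => hv (h hvs)⟩, fun h => h.2 hsF'⟩
      exact h.trans ((Set.subset_insert _ _).trans hsub)
    · rw [Finset.coe_insert, Set.union_insert, ← Set.insert_union]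
      exact psdReach_trans (psdReach_union hF' _) hSF

theorem exists_psdReach_of_singleton [Finite V] (hconn : G.Connected) (hG : IsCactus G) (v : V) :
    ∃ S : Finset V, S.card ≤ {s | IsCycleSet G s}.ncard ∧ PSDReach G ({v} ∪ S) Set.univ := by
  obtain ⟨S, hS, hSF⟩ := psdReach_exists_finset hconn hG {v} (Set.singleton_nonempty v)
  exact ⟨S, hS.trans (Set.ncard_le_ncard fun s hs => hs.1), hSF⟩

end UpperBound

/-! ### The zero forcing numbers of a cactus -/

section Values

variable {V : Type u} [Finite V] {G : SimpleGraph V}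

theorem tokensNeeded_singleton (hconn : G.Connected) (hG : IsCactus G) (v : V) :
    tokensNeeded G 0 {v} = {s | IsCycleSet G s}.ncard := by
  obtain ⟨S, hS, hSF⟩ := exists_psdReach_of_singleton hconn hG v
  have h : PlayerWins G 0 (0 + S.card) {v} :=
    playerWins_of_union _ _ (playerWins_of_psdReach hSF (.done 0))
  rw [zero_add] at h
  refine le_antisymm ((Nat.sInf_le h).trans hS) ?_
  exact ncard_le_of_playerWins_singleton hG (Nat.sInf_mem (s := {k | PlayerWins G 0 k {v}}) ⟨_, h⟩)

theorem Zq_zero_eq (hconn : G.Connected) (hG : IsCactus G) :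
    Zq G 0 = {s | IsCycleSet G s}.ncard + 1 := by
  have := hconn.nonempty
  obtain ⟨S, hS, hSF⟩ := exists_psdReach_of_singleton hconn hG (Classical.arbitrary V)
  have h : PlayerWins G 0 (0 + S.card + 1) ∅ := .token _ _ (Classical.arbitrary V) <| by
    rw [insert_empty_eq]
    exact playerWins_of_union _ _ (playerWins_of_psdReach hSF (.done 0))
  rw [zero_add] at h
  refine le_antisymm ((Nat.sInf_le h).trans (Nat.succ_le_succ hS)) ?_
  exact ncard_add_one_le_of_playerWins_empty hG
    (Nat.sInf_mem (s := {k | PlayerWins G 0 k ∅}) ⟨_, h⟩)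

theorem ZPlus_eq (hconn : G.Connected) (hG : IsCactus G) :
    ZPlus G = {s | IsCycleSet G s}.ncard + 1 := by
  classical
  have := hconn.nonempty
  obtain ⟨S, hS, hSF⟩ := exists_psdReach_of_singleton hconn hG (Classical.arbitrary V)
  have h : (insert (Classical.arbitrary V) S).card ∈
      {k | ∃ S : Finset V, S.card = k ∧ PSDReach G (S : Set V) Set.univ} :=
    ⟨_, rfl, by rwa [Finset.coe_insert, ← Set.singleton_union]⟩
  refine le_antisymm
    ((Nat.sInf_le h).trans ((Finset.card_insert_le _ _).trans (Nat.succ_le_succ hS))) ?_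
  obtain ⟨S', hS', hSF'⟩ := Nat.sInf_mem ⟨_, h⟩
  rw [← Set.empty_union (S' : Set V)] at hSF'
  have h' : PlayerWins G 0 (0 + S'.card) ∅ :=
    playerWins_of_union _ _ (playerWins_of_psdReach hSF' (.done 0))
  rw [zero_add, hS'] at h'
  exact ncard_add_one_le_of_playerWins_empty hG h'

/-- Filling all vertices but one suffices, so there are fewer cycles than vertices. -/
theorem ncard_isCycleSet_lt (hconn : G.Connected) (hG : IsCactus G) :
    {s | IsCycleSet G s}.ncard < Nat.card V := by
  have := Fintype.ofFinite V
  have h : PlayerWins G 0 (0 + (Finset.univ : Finset V).card) ∅ :=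
    playerWins_of_union _ _ (by simpa using PlayerWins.done 0)
  have := hconn.nonempty
  have := ncard_add_one_le_of_playerWins_empty hG h
  rw [zero_add, Finset.card_univ, ← Nat.card_eq_fintype_card] at this
  exact this

end Values

/-! ### Cycles of subgraphs -/

section Subgraphs

open SimpleGraph

variable {V : Type u} {G : SimpleGraph V}

theorem IsCactus.of_injective {W : Type u} {H : SimpleGraph W} (hG : IsCactus G) (f : H →g G)
    (hf : Function.Injective f) : IsCactus H := by
  intro x y p q hp hq e hep heq e'
  have key : ∀ {z : W} (p : H.Walk z z) (e : Sym2 W), Sym2.map f e ∈ (p.map f).edges ↔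
      e ∈ p.edges := fun p e => by
    rw [Walk.edges_map, List.mem_map_of_injective (Sym2.map.injective hf)]
  rw [← key, ← key q]
  exact hG _ _ (hp.map hf) (hq.map hf) _ ((key p e).2 hep) ((key q e).2 heq) _

theorem isCycleSet_induce_iff (S : Set V) (s : Set S) :
    IsCycleSet (G.induce S) s ↔ IsCycleSet G (Subtype.val '' s) := by
  constructor
  · rintro ⟨x, p, hp, rfl⟩
    refine ⟨(Embedding.induce S).toHom x, p.map (Embedding.induce S).toHom,
      hp.map Subtype.val_injective, ?_⟩
    ext y
    rw [Set.mem_ofPred_eq, Walk.support_map, List.mem_map]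
    rfl
  · rintro ⟨x, p, hp, hs⟩
    have hpS : ∀ y ∈ p.support, y ∈ S := by
      intro y hy
      obtain ⟨z, -, rfl⟩ := hs.ge hy
      exact z.2
    refine ⟨_, p.induce S hpS, .of_map (f := (Embedding.induce S).toHom) ?_, ?_⟩
    · rwa [Walk.map_induce]
    · ext y
      rw [Set.mem_ofPred_eq, Walk.support_induce, List.mem_attachWith]
      exact (Subtype.val_injective.mem_set_image).symm.trans (Set.ext_iff.1 hs _)

theorem ncard_isCycleSet_induce (S : Set V) :
    {s | IsCycleSet (G.induce S) s}.ncard = {s | IsCycleSet G s ∧ s ⊆ S}.ncard := by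
  rw [← Set.ncard_image_of_injective _ Subtype.val_injective.image_injective]
  congr 1
  ext s
  constructor
  · rintro ⟨s, hs, rfl⟩
    exact ⟨(isCycleSet_induce_iff S s).1 hs, Subtype.coe_image_subset S s⟩
  · rintro ⟨hs, hsS⟩
    have h : Subtype.val '' (Subtype.val ⁻¹' s : Set S) = s := by
      rwa [Subtype.image_preimage_coe, Set.inter_eq_right]
    refine ⟨_, (isCycleSet_induce_iff S _).2 ?_, h⟩
    rwa [h]

end Subgraphs

/-! ### Rooted trees -/

section Trees

open SimpleGraph

variable {ν : Type u} [Fintype ν] {T : SimpleGraph ν}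

theorem mem_children {r C S : ν} :
    S ∈ children T r C ↔ T.Adj C S ∧ T.dist r S = T.dist r C + 1 := by
  simp [children]

/-- Induction from the leaves to the root. -/
theorem children_induction {r : ν} {P : ν → Prop}
    (h : ∀ C, (∀ S ∈ children T r C, P S) → P C) (C : ν) : P C := by
  induction hn : Fintype.card ν - T.dist r C using Nat.strong_induction_on generalizing C with
  | _ n ih =>
  refine h C fun S hS => ih _ ?_ S rfl
  have := dist_lt_card_of_mem_children T hS
  omega

theorem eq_of_mem_children (hT : T.IsTree) {r A B S : ν} (hA : S ∈ children T r A)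
    (hB : S ∈ children T r B) : A = B := by
  rw [mem_children] at hA hB
  obtain ⟨p, hp⟩ := hT.connected.exists_walk_length_eq_dist r A
  obtain ⟨q, hq⟩ := hT.connected.exists_walk_length_eq_dist r B
  have h1 := (p.concat hA.1).isPath_of_length_eq_dist (by rw [Walk.length_concat, hp, hA.2])
  have h2 := (q.concat hB.1).isPath_of_length_eq_dist (by rw [Walk.length_concat, hq, hB.2])
  have h := congrArg Walk.penultimate ((hT.existsUnique_path r S).unique h1 h2)
  rwa [Walk.penultimate_concat, Walk.penultimate_concat] at h

theorem dist_le_of_inSubtree {r C D : ν} (h : InSubtree T r C D) : T.dist r C ≤ T.dist r D := by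
  induction h with
  | refl => exact le_rfl
  | tail _ h ih =>
    have := (mem_children.1 h).2
    omega

theorem inSubtree_root (hT : T.Connected) (r D : ν) : InSubtree T r r D := by
  induction hn : T.dist r D generalizing D with
  | zero =>
    rw [hT.dist_eq_zero_iff.1 hn]
    exact .refl
  | succ n ih =>
    obtain ⟨p, hp⟩ := hT.exists_walk_length_eq_dist D r
    rw [dist_comm, hn] at hp
    cases p with
    | nil => simp at hp
    | @cons _ E _ h q =>
      have h1 : T.dist r E ≤ n := by
        rw [dist_comm]
        rw [Walk.length_cons] at hp
        exact (dist_le q).trans (by omega)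
      have h2 := hT.dist_triangle (u := r) (v := E) (w := D)
      rw [dist_eq_one_iff_adj.2 h.symm] at h2
      exact (ih E (by omega)).tail (mem_children.2 ⟨h.symm, by omega⟩)

/-- Different children of a node have disjoint subtrees. -/
theorem eq_of_inSubtree_of_inSubtree (hT : T.IsTree) {r S S' D : ν}
    (hd : T.dist r S = T.dist r S') (h : InSubtree T r S D) (h' : InSubtree T r S' D) :
    S = S' := by
  induction h with
  | refl =>
    rcases Relation.ReflTransGen.cases_tail h' with h' | ⟨E, hE, h'⟩
    · exact h'
    · have h1 := dist_le_of_inSubtree hE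
      have h2 := (mem_children.1 h').2
      omega
  | @tail E D hE hD ih =>
    rcases Relation.ReflTransGen.cases_tail h' with rfl | ⟨E', hE', hD'⟩
    · have h1 := dist_le_of_inSubtree hE
      have h2 := (mem_children.1 hD).2
      omega
    · rw [eq_of_mem_children hT hD' hD] at hE'
      exact ih hE'

open Classical in
/-- The total weight of the nodes in the subtree rooted at `C`. -/
noncomputable def subtreeSum (T : SimpleGraph ν) (w : ν → ℕ) (r C : ν) : ℕ :=
  ∑ D with InSubtree T r C D, w D

theorem subtreeSum_eq (hT : T.IsTree) (w : ν → ℕ) (r C : ν) :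
    subtreeSum T w r C = w C + ∑ S ∈ children T r C, subtreeSum T w r S := by
  classical
  unfold subtreeSum
  rw [← Finset.sum_biUnion, ← Finset.sum_insert]
  · refine Finset.sum_congr (Finset.ext fun D => ?_) fun _ _ => rfl
    simp only [Finset.mem_filter, Finset.mem_univ, true_and, Finset.mem_insert,
      Finset.mem_biUnion]
    constructor
    · intro h
      rcases Relation.ReflTransGen.cases_head h with h | ⟨S, hS, h⟩
      · exact Or.inl h.symm
      · exact Or.inr ⟨S, hS, h⟩
    · rintro (rfl | ⟨S, hS, h⟩)
      · exact .refl
      · exact .head hS h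
  · simp only [Finset.mem_filter, Finset.mem_univ, true_and, Finset.mem_biUnion, not_exists,
      not_and]
    intro S hS h
    have h1 := dist_le_of_inSubtree h
    have h2 := (mem_children.1 hS).2
    omega
  · intro S hS S' hS' hne
    refine Finset.disjoint_left.2 fun D h h' => hne ?_
    rw [Finset.mem_filter] at h h'
    refine eq_of_inSubtree_of_inSubtree hT ?_ h.2 h'.2
    rw [(mem_children.1 hS).2, (mem_children.1 hS').2]

theorem subtreeSum_one_le_card (r C : ν) : subtreeSum T (fun _ => 1) r C ≤ Fintype.card ν := by
  classical
  unfold subtreeSum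
  rw [← Finset.card_eq_sum_ones]
  exact Finset.card_le_univ _

end Trees

/-! ### Trees of cycles and singular vertices -/

section TreeRep

open SimpleGraph

variable {V : Type u} {G : SimpleGraph V}

theorem exists_mem_cactusNode (G : SimpleGraph V) (v : V) : ∃ A : CactusNode G, v ∈ A.1 := by
  by_cases h : ∃ s, IsCycleSet G s ∧ v ∈ s
  · obtain ⟨s, hs, hv⟩ := h
    exact ⟨⟨s, Or.inl hs⟩, hv⟩
  · push Not at h
    exact ⟨⟨{v}, Or.inr ⟨v, rfl, h⟩⟩, rfl⟩

theorem nonempty_cactusNode (A : CactusNode G) : A.1.Nonempty := by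
  obtain ⟨s, hs | ⟨v, rfl, -⟩⟩ := A
  · exact IsCycleSet.nonempty hs
  · exact ⟨v, rfl⟩

theorem AttachedAt.symm {A B : CactusNode G} {p : V} (h : AttachedAt G A B p) :
    ∃ q, AttachedAt G B A q := by
  obtain ⟨hA, hB | ⟨b, hb, hpb, hbr⟩⟩ := h
  · exact ⟨p, hB, Or.inl hA⟩
  · exact ⟨b, hb, Or.inr ⟨p, hA, hpb.symm, by rwa [Sym2.eq_swap]⟩⟩

theorem exists_isTreeRep [Finite V] (hconn : G.Connected) : ∃ T, IsTreeRep G T := by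
  let H : SimpleGraph (CactusNode G) :=
    { Adj := fun A B => A ≠ B ∧ ∃ p, AttachedAt G A B p
      symm := ⟨fun A B h => ⟨h.1.symm, h.2.elim fun _ h => AttachedAt.symm h⟩⟩
      loopless := ⟨fun A h => h.1 rfl⟩ }
  have hatt : ∀ {A B : CactusNode G} {p : V}, AttachedAt G A B p → H.Reachable A B := by
    intro A B p h
    by_cases hAB : A = B
    · rw [hAB]
    · exact Adj.reachable (G := H) ⟨hAB, p, h⟩
  have hwalk : ∀ {v w : V} (q : G.Walk v w), ∀ A B : CactusNode G, v ∈ A.1 → w ∈ B.1 →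
      H.Reachable A B := by
    intro v w q
    induction q with
    | nil => exact fun A B hA hB => hatt ⟨hA, Or.inl hB⟩
    | @cons v v' w h q ih =>
      intro A B hA hB
      obtain ⟨A', hA'⟩ := exists_mem_cactusNode G v'
      refine Reachable.trans ?_ (ih A' B hA' hB)
      rcases isBridge_or_exists_isCycleSet h with hb | ⟨s, hs, hv, hv', -⟩
      · exact hatt ⟨hA, Or.inr ⟨v', hA', h, hb⟩⟩
      · have h1 : AttachedAt G A ⟨s, Or.inl hs⟩ v := ⟨hA, Or.inl hv⟩
        have h2 : AttachedAt G ⟨s, Or.inl hs⟩ A' v' := ⟨hv', Or.inl hA'⟩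
        exact (hatt h1).trans (hatt h2)
  have := hconn.nonempty
  have hne : Nonempty (CactusNode G) :=
    ⟨(exists_mem_cactusNode G (Classical.arbitrary V)).choose⟩
  have hH : H.Connected := by
    refine { preconnected := fun A B => ?_, nonempty := hne }
    obtain ⟨v, hv⟩ := nonempty_cactusNode A
    obtain ⟨w, hw⟩ := nonempty_cactusNode B
    exact hwalk (hconn.preconnected v w).some A B hv hw
  obtain ⟨T, hle, hT⟩ := hH.exists_isTree_le
  exact ⟨T, hT, fun A B h => (hle h).2⟩

theorem reachable_induce_of_mem_cactusNode (A : CactusNode G) {S : Set V} (hS : A.1 ⊆ S) {v w : V}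
    (hv : v ∈ A.1) (hw : w ∈ A.1) : (G.induce S).Reachable ⟨v, hS hv⟩ ⟨w, hS hw⟩ := by
  classical
  obtain ⟨s, ⟨x, p, hp, rfl⟩ | ⟨x, rfl, -⟩⟩ := A
  · have key : ∀ y (hy : y ∈ p.support),
        (G.induce S).Reachable ⟨x, hS p.start_mem_support⟩ ⟨y, hS hy⟩ := fun y hy =>
      ((p.takeUntil y hy).induce S fun z hz =>
        hS (p.support_takeUntil_subset_support hy hz)).reachable
    exact (key v hv).symm.trans (key w hw)
  · obtain rfl : v = x := hv
    obtain rfl : w = v := hw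
    exact .refl _

variable [Finite V] {T : SimpleGraph (CactusNode G)}

theorem connected_induce_subtreeVerts (hT : IsTreeRep G T) (r C : CactusNode G) :
    (G.induce (subtreeVerts G T r C)).Connected := by
  have hsub : ∀ D, InSubtree T r C D → D.1 ⊆ subtreeVerts G T r C :=
    fun D hD v hv => ⟨D, hD, hv⟩
  obtain ⟨c, hc⟩ := nonempty_cactusNode C
  have key : ∀ D (hD : InSubtree T r C D) v (hv : v ∈ D.1),
      (G.induce (subtreeVerts G T r C)).Reachable ⟨c, hsub C .refl hc⟩ ⟨v, hsub D hD hv⟩ := by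
    intro D hD
    induction hD with
    | refl => exact fun v hv => reachable_induce_of_mem_cactusNode C (hsub C .refl) hc hv
    | @tail B D hB hD ih =>
      intro v hv
      have hD' : InSubtree T r C D := hB.tail hD
      obtain ⟨p, hpB, hp | ⟨b, hb, hpb, -⟩⟩ := hT.2 B D (mem_children.1 hD).1
      · exact (ih p hpB).trans (reachable_induce_of_mem_cactusNode D (hsub D hD') hp hv)
      · refine (ih p hpB).trans (Reachable.trans ?_
          (reachable_induce_of_mem_cactusNode D (hsub D hD') hb hv))
        exact Adj.reachable (induce_adj.2 hpb)
  refine (connected_iff_exists_forall_reachable _).2 ⟨⟨c, hsub C .refl hc⟩, ?_⟩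
  rintro ⟨v, D, hD, hv⟩
  exact key D hD v hv

/-- A cycle inside the vertex set of a subtree is a node of this subtree: the projection onto a
cycle that is not a node of the subtree is constant on the subtree. -/
theorem inSubtree_of_subset_subtreeVerts (hG : IsCactus G) (hT : IsTreeRep G T)
    {r C D : CactusNode G} (hD : IsCycleSet G D.1) (hsub : D.1 ⊆ subtreeVerts G T r C) :
    InSubtree T r C D := by
  by_contra hDC
  obtain ⟨π, hπ, hπb, hπc⟩ := exists_projection hG hD
  have hnode : ∀ A : CactusNode G, InSubtree T r C A → ∀ v ∈ A.1, ∀ w ∈ A.1, π v = π w := by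
    intro A hA v hv w hw
    have hne : A.1 ≠ D.1 := fun h => hDC (Subtype.ext h ▸ hA)
    rcases A.2 with hs | ⟨x, hx, -⟩
    · exact hπc A.1 hs hne v hv w hw
    · rw [hx] at hv hw
      rw [Set.mem_singleton_iff.1 hv, Set.mem_singleton_iff.1 hw]
  obtain ⟨c, hc⟩ := nonempty_cactusNode C
  have key : ∀ A, InSubtree T r C A → ∀ v ∈ A.1, π v = π c := by
    intro A hA
    induction hA with
    | refl => exact fun v hv => hnode C .refl v hv c hc
    | @tail B A hB hA ih =>
      intro v hv
      have hA' : InSubtree T r C A := hB.tail hA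
      obtain ⟨p, hpB, hp | ⟨b, hb, hpb, hbr⟩⟩ := hT.2 B A (mem_children.1 hA).1
      · rw [hnode A hA' v hv p hp, ih p hpB]
      · rw [hnode A hA' v hv b hb, ← hπb p b hpb hbr, ih p hpB]
  obtain ⟨x, hx⟩ := IsCycleSet.nonempty hD
  obtain ⟨y, hy, hyx⟩ := IsCycleSet.exists_ne hD x
  obtain ⟨A, hA, hxA⟩ := hsub hx
  obtain ⟨B, hB, hyB⟩ := hsub hy
  have h1 := key A hA x hxA
  have h2 := key B hB y hyB
  rw [hπ x hx] at h1
  rw [hπ y hy] at h2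
  exact hyx (h2.trans h1.symm)

open Classical in
/-- The number of cycles among the nodes of the subtree rooted at `C`. -/
noncomputable def subtreeCycles (T : SimpleGraph (CactusNode G)) (r C : CactusNode G) : ℕ :=
  subtreeSum T (fun D => if IsCycleSet G D.1 then 1 else 0) r C

theorem ncard_isCycleSet_subtreeVerts (hG : IsCactus G) (hT : IsTreeRep G T)
    (r C : CactusNode G) :
    {s | IsCycleSet (G.induce (subtreeVerts G T r C)) s}.ncard = subtreeCycles T r C := by
  classical
  rw [ncard_isCycleSet_induce, subtreeCycles, subtreeSum, Finset.sum_boole, Nat.cast_id,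
    Finset.filter_filter, ← Set.ncard_coe_finset,
    ← Set.ncard_image_of_injective _ Subtype.val_injective]
  congr 1
  ext s
  simp only [Set.mem_ofPred_eq, Set.mem_image, Finset.mem_coe, Finset.mem_filter,
    Finset.mem_univ, true_and]
  constructor
  · rintro ⟨hs, hsub⟩
    exact ⟨⟨s, Or.inl hs⟩, ⟨inSubtree_of_subset_subtreeVerts hG hT hs hsub, hs⟩, rfl⟩
  · rintro ⟨D, ⟨hD, hs⟩, rfl⟩
    exact ⟨hs, fun v hv => ⟨D, hD, hv⟩⟩

theorem Zq_subtreeVerts (hG : IsCactus G) (hT : IsTreeRep G T) (r C : CactusNode G) :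
    Zq (G.induce (subtreeVerts G T r C)) 0 = subtreeCycles T r C + 1 := by
  rw [Zq_zero_eq (connected_induce_subtreeVerts hT r C)
    (IsCactus.of_injective hG (Embedding.induce _).toHom Subtype.val_injective),
    ncard_isCycleSet_subtreeVerts hG hT]

theorem tokensNeeded_subtreeVerts (hG : IsCactus G) (hT : IsTreeRep G T) {r C : CactusNode G}
    {p : V} (hp : p ∈ C.1) :
    tokensNeeded (G.induce (subtreeVerts G T r C)) 0 {x | x.1 = p} = subtreeCycles T r C := by
  have : {x : subtreeVerts G T r C | x.1 = p} = {⟨p, C, .refl, hp⟩} := by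
    ext x
    exact ⟨fun h => Subtype.ext h, fun h => congrArg Subtype.val h⟩
  rw [this, tokensNeeded_singleton (connected_induce_subtreeVerts hT r C)
    (IsCactus.of_injective hG (Embedding.induce _).toHom Subtype.val_injective),
    ncard_isCycleSet_subtreeVerts hG hT]

theorem Zq_eq_subtreeCycles_root (hconn : G.Connected) (hG : IsCactus G) (hT : IsTreeRep G T)
    (r : CactusNode G) : Zq G 0 = subtreeCycles T r r + 1 := by
  rw [Zq_zero_eq hconn hG, ← ncard_isCycleSet_subtreeVerts hG hT, ncard_isCycleSet_induce]
  congr 2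
  ext s
  refine (and_iff_left fun v _ => ?_).symm
  obtain ⟨A, hA⟩ := exists_mem_cactusNode G v
  exact ⟨A, inSubtree_root hT.1.connected r A, hA⟩

theorem card_cactusNode_le (hconn : G.Connected) (hG : IsCactus G) :
    Fintype.card (CactusNode G) ≤ 2 * Nat.card V := by
  have h1 := ncard_isCycleSet_lt hconn hG
  have h2 : {s | IsSingularSet G s}.ncard ≤ Nat.card V := by
    rw [← Set.ncard_univ]
    refine (Set.ncard_le_ncard ?_).trans (Set.ncard_image_le (f := fun v => ({v} : Set V)))
    rintro s ⟨v, rfl, -⟩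
    exact ⟨v, trivial, rfl⟩
  rw [← Nat.card_eq_fintype_card]
  have h3 : Nat.card (CactusNode G) ≤ _ :=
    Set.ncard_union_le {s | IsCycleSet G s} {s | IsSingularSet G s}
  omega

end TreeRep

/-! ### The values of the recurrence -/

section Recurrence

/-- The `k`-th smallest of `j` differences `min_k Z₀(S,0,k) - min_k Z₀(S,1,k)`; all these
differences turn out to be `1`. -/
def kthDiff (k j : ℕ) : ℕ∞ := if j < k then ⊤ else 1

theorem one_le_kthDiff (k j : ℕ) : 1 ≤ kthDiff k j := by
  unfold kthDiff
  split_ifs <;> simp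

open Classical in
/-- The values at a node, in terms of the sum `σ` of the values `min_k Z₀(S,1,k)` of the children
and of the two smallest differences. -/
noncomputable def nodeVal (cyc : Prop) (σ m₁ m₂ : ℕ∞) : Fin 2 → Fin 3 → ℕ∞ :=
  if cyc then fun
    | 0, 0 => 2 + σ
    | 0, 1 => 1 + (σ + m₁)
    | 0, 2 => σ + m₁ + m₂
    | 1, 0 => 1 + σ
    | 1, 1 => σ + m₁
    | 1, 2 => ⊤
  else fun
    | 0, 0 => 1 + σ
    | 0, 1 => σ + m₁
    | 1, 0 => σ
    | _, _ => ⊤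

theorem iInf_fin_three (f : Fin 3 → ℕ∞) : ⨅ k, f k = min (min (f 0) (f 1)) (f 2) := by
  refine le_antisymm (le_min (le_min (iInf_le _ _) (iInf_le _ _)) (iInf_le _ _)) (le_iInf ?_)
  intro k
  fin_cases k
  · exact (min_le_left _ _).trans (min_le_left _ _)
  · exact (min_le_left _ _).trans (min_le_right _ _)
  · exact min_le_right _ _

theorem two_add_le_of_one_le {σ m₁ m₂ : ℕ∞} (h₁ : 1 ≤ m₁) (h₂ : 1 ≤ m₂) : 2 + σ ≤ σ + m₁ + m₂ := by
  calc 2 + σ = σ + 1 + 1 := by rw [add_comm, add_assoc, one_add_one_eq_two]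
    _ ≤ σ + m₁ + m₂ := by gcongr

open Classical in
theorem min_nodeVal_zero (cyc : Prop) (σ : ℕ) {m₁ m₂ : ℕ∞} (h₁ : 1 ≤ m₁) (h₂ : 1 ≤ m₂) :
    ⨅ k, nodeVal cyc σ m₁ m₂ 0 k = (((if cyc then 1 else 0) + σ : ℕ) : ℕ∞) + 1 := by
  have h : (1 : ℕ∞) + σ ≤ σ + m₁ := by
    rw [add_comm]
    gcongr
  rw [iInf_fin_three]
  by_cases hc : cyc
  · simp only [nodeVal, hc, if_true]
    rw [min_eq_left, min_eq_left]
    · push_cast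
      rw [← one_add_one_eq_two, add_right_comm]
    · rw [← one_add_one_eq_two, add_assoc]
      gcongr
    · exact (min_le_left _ _).trans (two_add_le_of_one_le h₁ h₂)
  · simp only [nodeVal, hc, if_false]
    rw [min_eq_left le_top, min_eq_left h, zero_add, add_comm]

open Classical in
theorem min_nodeVal_one (cyc : Prop) (σ : ℕ) {m₁ : ℕ∞} (m₂ : ℕ∞) (h₁ : 1 ≤ m₁) :
    ⨅ k, nodeVal cyc σ m₁ m₂ 1 k = (((if cyc then 1 else 0) + σ : ℕ) : ℕ∞) := by
  have h : (1 : ℕ∞) + σ ≤ σ + m₁ := by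
    rw [add_comm]
    gcongr
  rw [iInf_fin_three]
  by_cases hc : cyc
  · simp only [nodeVal, hc, if_true]
    rw [min_eq_left le_top, min_eq_left h]
    push_cast
    rfl
  · simp only [nodeVal, hc, if_false]
    rw [min_eq_left le_top, min_eq_left le_top, zero_add]

theorem biInf_finset_eq {ν : Type u} (s : Finset ν) {f : ν → ℕ∞} {c : ℕ∞}
    (h : ∀ x ∈ s, f x = c) : ⨅ x ∈ s, f x = if s.card = 0 then ⊤ else c := by
  rw [show ⨅ x ∈ s, f x = ⨅ x ∈ s, c from iInf_congr fun x => iInf_congr fun hx => h x hx]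
  split_ifs with hs
  · rw [Finset.card_eq_zero.1 hs]
    simp
  · obtain ⟨x, hx⟩ := Finset.card_pos.1 (Nat.pos_of_ne_zero hs)
    exact le_antisymm (iInf₂_le x hx) (le_iInf₂ fun _ _ => le_rfl)

/-- The right-hand sides of the recurrence when the two minima at each child differ by one. -/
theorem recurrenceRhs_eq_nodeVal {ν : Type u} (cyc : Prop) (ch : Finset ν)
    (Z : ν → Fin 2 → Fin 3 → ℕ∞) (a : ν → ℕ) (h0 : ∀ S ∈ ch, ⨅ k, Z S 0 k = (a S : ℕ∞) + 1)
    (h1 : ∀ S ∈ ch, ⨅ k, Z S 1 k = (a S : ℕ∞)) :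
    recurrenceRhs cyc ch Z =
      nodeVal cyc ((∑ S ∈ ch, a S : ℕ) : ℕ∞) (kthDiff 1 ch.card) (kthDiff 2 ch.card) := by
  classical
  have hsum : ∀ s ⊆ ch, (∑ S ∈ s, ⨅ k, Z S 1 k) = ((∑ S ∈ s, a S : ℕ) : ℕ∞) := fun s hs => by
    rw [Nat.cast_sum]
    exact Finset.sum_congr rfl fun S hS => h1 S (hs hS)
  have e1 := hsum ch subset_rfl
  have e2 : (⨅ H ∈ ch, ((∑ S ∈ ch.erase H, ⨅ k', Z S 1 k') + ⨅ k, Z H 0 k)) =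
      ((∑ S ∈ ch, a S : ℕ) : ℕ∞) + kthDiff 1 ch.card := by
    rw [biInf_finset_eq ch (c := ((∑ S ∈ ch, a S : ℕ) : ℕ∞) + 1)]
    · simp only [kthDiff, Nat.lt_one_iff]
      split_ifs <;> simp
    · intro H hH
      rw [hsum _ (Finset.erase_subset _ _), h0 H hH, ← Finset.sum_erase_add _ _ hH]
      push_cast
      ring
  have e3 : (⨅ H ∈ ch, ⨅ Q ∈ ch.erase H,
        ((∑ S ∈ (ch.erase H).erase Q, ⨅ k'', Z S 1 k'') + (⨅ k', Z H 0 k') + ⨅ k, Z Q 0 k)) =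
      ((∑ S ∈ ch, a S : ℕ) : ℕ∞) + kthDiff 1 ch.card + kthDiff 2 ch.card := by
    rw [biInf_finset_eq ch (c := ((∑ S ∈ ch, a S : ℕ) : ℕ∞) + 1 + kthDiff 2 ch.card)]
    · simp only [kthDiff, Nat.lt_one_iff]
      split_ifs <;> simp
    · intro H hH
      rw [biInf_finset_eq (ch.erase H) (c := ((∑ S ∈ ch, a S : ℕ) : ℕ∞) + 1 + 1)]
      · have := Finset.card_pos.2 ⟨H, hH⟩
        have hc : ch.card - 1 = 0 ↔ ch.card < 2 := by omega
        simp only [Finset.card_erase_of_mem hH, hc, kthDiff]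
        split_ifs <;> simp
      · intro Q hQ
        rw [hsum _ ((Finset.erase_subset _ _).trans (Finset.erase_subset _ _)), h0 H hH,
          h0 Q (Finset.mem_of_mem_erase hQ), ← Finset.sum_erase_add _ _ hH,
          ← Finset.sum_erase_add _ _ hQ]
        push_cast
        ring
  unfold recurrenceRhs nodeVal
  rw [e1, e2, e3]

/-- Scanning children whose two minima differ by one. -/
theorem foldl_push_eq {ν : Type u} (l : List ν) (f : ν → EvalResult) (a : ν → ℕ)
    (hf : ∀ S ∈ l, (f S).dp 0 = (a S : ℕ∞) + 1 ∧ (f S).dp 1 = (a S : ℕ∞)) (σ j ops : ℕ) :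
    ∃ ops', (l.map f).foldl ScanState.push ⟨σ, kthDiff 1 j, kthDiff 2 j, ops⟩ =
        ⟨((σ + (l.map a).sum : ℕ) : ℕ∞), kthDiff 1 (j + l.length), kthDiff 2 (j + l.length), ops'⟩ ∧
      ops' ≤ ops + (l.map fun S => (f S).ops + 5).sum := by
  induction l generalizing σ j ops with
  | nil => exact ⟨ops, by simp, by simp⟩
  | cons S l ih =>
    obtain ⟨h0, h1⟩ := hf S (by simp)
    -- the subtraction is truncated; it is exact here because `a S` is finite
    have hd : (f S).dp 0 - (f S).dp 1 = 1 := by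
      rw [h0, h1, add_comm]
      exact (ENat.addLECancellable_natCast _).add_tsub_cancel_right
    obtain ⟨ops₁, hpush, hops₁⟩ : ∃ ops₁,
        ScanState.push ⟨σ, kthDiff 1 j, kthDiff 2 j, ops⟩ (f S) =
          ⟨((σ + a S : ℕ) : ℕ∞), kthDiff 1 (j + 1), kthDiff 2 (j + 1), ops₁⟩ ∧
        ops₁ ≤ ops + ((f S).ops + 5) := by
      unfold ScanState.push
      simp only [hd]
      simp only [h1]
      rcases j with _ | _ | j
      · exact ⟨ops + (f S).ops + 4, by simp [kthDiff], by omega⟩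
      · exact ⟨ops + (f S).ops + 5, by simp [kthDiff], by omega⟩
      · exact ⟨ops + (f S).ops + 5, by simp [kthDiff], by omega⟩
    obtain ⟨ops', hfold, hops'⟩ := ih (fun S hS => hf S (by simp [hS])) (σ + a S) (j + 1) ops₁
    refine ⟨ops', ?_, ?_⟩
    · rw [List.map_cons, List.foldl_cons, hpush, hfold, List.map_cons, List.sum_cons,
        List.length_cons, add_assoc, add_assoc, add_comm 1]
    · rw [List.map_cons, List.sum_cons]
      omega

variable {ν : Type u} [Fintype ν] {T : SimpleGraph ν}

open Classical in
theorem min_dpVal_eq (hT : T.IsTree) (isCycle : ν → Prop) (r C : ν) :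
    ⨅ k, dpVal T isCycle r C 0 k =
        (subtreeSum T (fun D => if isCycle D then 1 else 0) r C : ℕ∞) + 1 ∧
      ⨅ k, dpVal T isCycle r C 1 k =
        (subtreeSum T (fun D => if isCycle D then 1 else 0) r C : ℕ∞) := by
  induction C using children_induction (T := T) (r := r) with
  | h C ih =>
    rw [dpVal_eq, recurrenceRhs_eq_nodeVal _ _ _ _ (fun S hS => (ih S hS).1)
      (fun S hS => (ih S hS).2), subtreeSum_eq hT]
    exact ⟨min_nodeVal_zero _ _ (one_le_kthDiff _ _) (one_le_kthDiff _ _),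
      min_nodeVal_one _ _ _ (one_le_kthDiff _ _)⟩

open Classical in
theorem dpVal_eq_nodeVal (hT : T.IsTree) (isCycle : ν → Prop) (r C : ν) :
    dpVal T isCycle r C = nodeVal (isCycle C)
      ((∑ S ∈ children T r C, subtreeSum T (fun D => if isCycle D then 1 else 0) r S : ℕ) : ℕ∞)
      (kthDiff 1 (children T r C).card) (kthDiff 2 (children T r C).card) := by
  rw [dpVal_eq]
  exact recurrenceRhs_eq_nodeVal _ _ _ _ (fun S _ => (min_dpVal_eq hT isCycle r S).1)
    (fun S _ => (min_dpVal_eq hT isCycle r S).2)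

/-! ### The step-counted evaluation -/

theorem evalTree_eq (isCycle : ν → Prop) (r C : ν) :
    evalTree T isCycle r C =
      evalNode (isCycle C) ((children T r C).toList.map (evalTree T isCycle r)) := by
  conv_lhs => rw [evalTree, treeFold]
  congr 1
  refine List.map_congr_left fun S hS => ?_
  rw [Finset.mem_toList] at hS
  rw [dif_pos hS]
  rfl

open Classical in
/-- The evaluation computes the values of the recurrence, in at most `14` steps for each node of
the subtree. -/
theorem evalTree_spec (hT : T.IsTree) (isCycle : ν → Prop) (r C : ν) :
    (evalTree T isCycle r C).val = dpVal T isCycle r C ∧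
      (evalTree T isCycle r C).dp 0 =
        (subtreeSum T (fun D => if isCycle D then 1 else 0) r C : ℕ∞) + 1 ∧
      (evalTree T isCycle r C).dp 1 =
        (subtreeSum T (fun D => if isCycle D then 1 else 0) r C : ℕ∞) ∧
      (evalTree T isCycle r C).ops + 5 ≤ 14 * subtreeSum T (fun _ => 1) r C := by
  induction C using children_induction (T := T) (r := r) with
  | h C ih =>
    obtain ⟨ops, hfold, hops⟩ := foldl_push_eq (children T r C).toList (evalTree T isCycle r)
      (subtreeSum T (fun D => if isCycle D then 1 else 0) r)
      (fun S hS => have h := ih S (Finset.mem_toList.1 hS); ⟨h.2.1, h.2.2.1⟩) 0 0 0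
    rw [Finset.length_toList, Finset.sum_map_toList, zero_add, zero_add,
      show kthDiff 1 0 = ⊤ from rfl, show kthDiff 2 0 = ⊤ from rfl, Nat.cast_zero] at hfold
    rw [Finset.sum_map_toList, zero_add] at hops
    have hops' : ops + 14 ≤ 14 * subtreeSum T (fun _ => 1) r C := by
      rw [subtreeSum_eq hT, mul_add, Finset.mul_sum]
      have := Finset.sum_le_sum fun S hS => (ih S hS).2.2.2
      omega
    have h0 := (min_dpVal_eq hT isCycle r C).1
    have h1 := (min_dpVal_eq hT isCycle r C).2
    rw [iInf_fin_three] at h0 h1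
    rw [dpVal_eq_nodeVal hT] at h0 h1 ⊢
    rw [evalTree_eq, evalNode, hfold]
    by_cases hc : isCycle C
    · simp only [hc, if_true, nodeVal] at h0 h1 ⊢
      rw [min_eq_left le_top] at h1
      exact ⟨trivial, h0, h1, by omega⟩
    · simp only [hc, if_false, nodeVal] at h0 h1 ⊢
      rw [min_eq_left le_top] at h0
      rw [min_eq_left le_top, min_eq_left le_top] at h1
      exact ⟨trivial, h0, h1, by omega⟩

theorem evalAllOps_le (hT : T.IsTree) (isCycle : ν → Prop) :
    evalAllOps T isCycle ≤ 14 * Fintype.card ν ^ 2 := by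
  have h : ∀ r, (evalTree T isCycle r r).ops + 1 ≤ 14 * Fintype.card ν := fun r => by
    have h1 := (evalTree_spec hT isCycle r r).2.2.2
    have h2 := subtreeSum_one_le_card (T := T) r r
    omega
  refine (Finset.sum_le_sum fun r _ => h r).trans (le_of_eq ?_)
  rw [Finset.sum_const, Finset.card_univ, smul_eq_mul]
  ring

end Recurrence

/-! ### The number of cycles of a cactus -/

section EdgeCount

open SimpleGraph

variable {V : Type u}

/-- Deleting an edge of a cycle of a cactus removes this cycle and no other one. -/
theorem isCycleSet_deleteEdges_iff {G : SimpleGraph V} (hG : IsCactus G) {a : V} {p : G.Walk a a}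
    (hp : p.IsCycle) {e : Sym2 V} (he : e ∈ p.edges) (s : Set V) :
    IsCycleSet (G.deleteEdges {e}) s ↔ IsCycleSet G s ∧ s ≠ {v | v ∈ p.support} := by
  constructor
  · rintro ⟨b, q, hq, rfl⟩
    have hq' := hq.mapLe (G.deleteEdges_le {e})
    refine ⟨⟨b, _, hq', by simp⟩, fun h => ?_⟩
    have heq := (mem_edges_iff_of_support_eq hG hp hq'
      (fun v => by simpa using (Set.ext_iff.1 h v).symm) e).1 he
    rw [Walk.edges_mapLe_eq_edges] at heq
    have := q.edges_subset_edgeSet heq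
    rw [edgeSet_deleteEdges] at this
    exact this.2 rfl
  · rintro ⟨⟨b, q, hq, rfl⟩, hne⟩
    have heq : ∀ e' ∈ q.edges, e' ∉ ({e} : Set (Sym2 V)) := by
      rintro e' he' rfl
      exact hne (Set.ext fun v => (mem_support_iff_of_mem_edges hG hp hq he he' v).symm)
    refine ⟨b, q.toDeleteEdges ({e} : Set (Sym2 V)) heq, hq.toDeleteEdges _ _ heq, ?_⟩
    simp [Walk.toDeleteEdges]

/-- A connected cactus becomes a tree when one edge of each cycle is deleted. -/
theorem ncard_isCycleSet_add_card [Finite V] {G : SimpleGraph V} (hconn : G.Connected)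
    (hG : IsCactus G) : {s | IsCycleSet G s}.ncard + Nat.card V = G.edgeSet.ncard + 1 := by
  induction hn : {s | IsCycleSet G s}.ncard generalizing G with
  | zero =>
    have := Fintype.ofFinite V
    have := Fintype.ofFinite G.edgeSet
    rw [Set.ncard_eq_zero] at hn
    have hT : G.IsTree := ⟨hconn, fun a p hp =>
      Set.notMem_empty {v | v ∈ p.support} (hn ▸ ⟨a, p, hp, rfl⟩)⟩
    rw [Nat.card_eq_fintype_card, ← hT.card_edgeFinset, ← Set.ncard_coe_finset, coe_edgeFinset,
      zero_add]
  | succ n ih =>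
    obtain ⟨s, a, p, hp, rfl⟩ := Set.nonempty_of_ncard_ne_zero (hn.trans_ne n.succ_ne_zero)
    obtain ⟨w, z, r, hw, -, -, -, -, hE, -⟩ := exists_split_of_isCycle hp p.start_mem_support
    have he : s(a, w) ∈ p.edges := (hE _).2 (Or.inl rfl)
    have hset : {s | IsCycleSet (G.deleteEdges {s(a, w)}) s} =
        {s | IsCycleSet G s} \ {{v | v ∈ p.support}} :=
      Set.ext fun s => isCycleSet_deleteEdges_iff hG hp he s
    have h := ih (G := G.deleteEdges {s(a, w)})
      (hconn.connected_delete_edge_of_not_isBridge fun hb => hb.notMem_edges_of_isCycle hp he)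
      (IsCactus.of_injective hG (.ofLE (G.deleteEdges_le _)) Function.injective_id) (by
        have := Set.ncard_sdiff_singleton_add_one (s := {s | IsCycleSet G s}) ⟨a, p, hp, rfl⟩
        rw [hset]
        omega)
    rw [edgeSet_deleteEdges] at h
    have := Set.ncard_sdiff_singleton_add_one (s := G.edgeSet) (a := s(a, w)) hw
    omega

end EdgeCount

/-! ### The program -/

section Program

theorem ramInput_mem_eq {n : ℕ} (G : SimpleGraph (Fin n)) (x y : Fin n) [Decidable (G.Adj x y)] :
    (ramInput n G).mem (x * n + y) = if G.Adj x y then 1 else 0 := by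
  classical
  refine if_congr ⟨?_, fun h => ⟨x, y, rfl, h⟩⟩ rfl rfl
  rintro ⟨x', y', h, hadj⟩
  have hn : 0 < n := x.pos
  have hdiv : ∀ x y : Fin n, (x.1 * n + y.1) / n = x := fun x y => by
    rw [mul_comm, Nat.mul_add_div hn, Nat.div_eq_of_lt y.2, add_zero]
  have hmod : ∀ x y : Fin n, (x.1 * n + y.1) % n = y := fun x y => by
    rw [mul_comm, Nat.mul_add_mod, Nat.mod_eq_of_lt y.2]
  have hx : x = x' := Fin.ext (by rw [← hdiv x y, h, hdiv])
  have hy : y = y' := Fin.ext (by rw [← hmod x y, h, hmod])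
  rwa [hx, hy]

theorem ramInput_mem_le_one {n : ℕ} (G : SimpleGraph (Fin n)) (a : ℕ) :
    (ramInput n G).mem a ≤ 1 := by
  unfold ramInput
  dsimp only
  split_ifs <;> simp

/-- The entries below the diagonal of the adjacency matrix count the edges. -/
theorem sum_ramInput_mem {n : ℕ} (G : SimpleGraph (Fin n)) :
    ∑ i ∈ Finset.range n, ∑ j ∈ Finset.range i, (ramInput n G).mem (i * n + j) =
      G.edgeSet.ncard := by
  classical
  rw [Finset.sum_range, ← SimpleGraph.coe_edgeFinset, Set.ncard_coe_finset]
  have h : ∀ i : Fin n, ∑ j ∈ Finset.range i, (ramInput n G).mem (i * n + j) =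
      ∑ j : Fin n, if j < i ∧ G.Adj i j then 1 else 0 := by
    intro i
    have : ∀ j : Fin n, (if j < i ∧ G.Adj i j then 1 else 0) =
        if j.1 < i.1 then (ramInput n G).mem (i * n + j) else 0 := by
      intro j
      rw [ramInput_mem_eq, ← ite_and]
      rfl
    simp only [this]
    rw [← Finset.sum_range (fun j => if j < i.1 then (ramInput n G).mem (i * n + j) else 0),
      ← Finset.sum_filter]
    refine Finset.sum_congr (Finset.ext fun j => ?_) fun _ _ => rfl
    simp only [Finset.mem_range, Finset.mem_filter]
    have := i.2
    omega
  simp only [h]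
  rw [← Finset.sum_product', Finset.sum_boole, Nat.cast_id]
  refine Finset.card_bij (fun x _ => s(x.1, x.2)) ?_ ?_ ?_
  · intro x hx
    rw [Finset.mem_filter] at hx
    exact SimpleGraph.mem_edgeFinset.2 hx.2.2
  · rintro ⟨x, y⟩ h ⟨x', y'⟩ h' heq
    rw [Finset.mem_filter] at h h'
    rcases Sym2.eq_iff.1 heq with ⟨rfl, rfl⟩ | ⟨rfl, rfl⟩
    · rfl
    · exact absurd h.2.1 (lt_asymm h'.2.1)
  · intro e he
    induction e with | _ x y
    rw [SimpleGraph.mem_edgeFinset, SimpleGraph.mem_edgeSet] at he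
    rcases lt_or_gt_of_ne he.ne with hxy | hxy
    · exact ⟨(y, x), by simp [hxy, he.symm], Sym2.eq_swap⟩
    · exact ⟨(x, y), by simp [hxy, he], rfl⟩

open RamExpr RamProg

/-- Adds the first `r₁` entries of the row of the adjacency matrix that starts at the address `r₄`
to `r₃`. -/
def rowProg : RamProg :=
  .loop (.add (.var 2) (.lit 1)) (.var 1)
    (.seq (.assign 3 (.add (.var 3) (.load (.add (.var 4) (.var 2)))))
      (.assign 2 (.add (.var 2) (.lit 1))))

/-- Adds the entries below the diagonal of the adjacency matrix to `r₃`. -/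
def edgesProg : RamProg :=
  .loop (.add (.var 1) (.lit 1)) (.var 0)
    (.seq (.assign 2 (.lit 0)) (.seq rowProg
      (.seq (.assign 4 (.add (.var 4) (.var 0))) (.assign 1 (.add (.var 1) (.lit 1))))))

/-- Computes `m + 2 - n` for a graph with `n` vertices and `m` edges. -/
def cactusProg : RamProg :=
  .seq (.assign 3 (.lit 2)) (.seq edgesProg (.assign 0 (.sub (.var 3) (.var 0))))

/-- The state with the memory `M` and the registers `n`, `i`, `j`, `a`, `b`, `0`, `0`, …. -/
def progState (M : ℕ → ℕ) (n i j a b : ℕ) : RamState where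
  reg := fun
    | 0 => n
    | 1 => i
    | 2 => j
    | 3 => a
    | 4 => b
    | _ => 0
  mem := M

theorem ramExec_assign {W : ℕ} {i : ℕ} {e : RamExpr} {s s' : RamState} {t : ℕ} (h : e.eval s ≤ W)
    (hs : ∀ k, s'.reg k = if k = i then e.eval s else s.reg k) (hm : s'.mem = s.mem)
    (ht : t = e.cost + 1) : RamExec W (.assign i e) s t s' := by
  have : s' = ⟨Function.update s.reg i (e.eval s), s.mem⟩ :=
    RamState.ext (funext fun k => (hs k).trans (Function.update_apply ..).symm) hm
  rw [ht, this]
  exact .assign s i e h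

theorem rowProg_exec {W n i b : ℕ} (M : ℕ → ℕ) (hi : i ≤ W) (k j a : ℕ) (hk : j + k = i)
    (ha : a + ∑ x ∈ Finset.range k, M (b + (j + x)) ≤ W) :
    RamExec W rowProg (progState M n i j a b) (16 * k + 5)
      (progState M n i i (a + ∑ x ∈ Finset.range k, M (b + (j + x))) b) := by
  induction k generalizing j a with
  | zero =>
    obtain rfl : j = i := by omega
    exact .loopFalse _ _ _ _ (by simp [eval, progState])
  | succ k ih =>
    have hsum : a + ∑ x ∈ Finset.range (k + 1), M (b + (j + x)) =
        a + M (b + j) + ∑ x ∈ Finset.range k, M (b + (j + 1 + x)) := by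
      rw [Finset.sum_range_succ', add_zero, add_assoc a, add_comm (M (b + j))]
      simp only [add_assoc, add_comm 1]
    rw [hsum] at ha ⊢
    have h1 : RamExec W (.assign 3 (.add (.var 3) (.load (.add (.var 4) (.var 2)))))
        (progState M n i j a b) 7 (progState M n i j (a + M (b + j)) b) :=
      ramExec_assign (by simp only [eval, progState]; omega)
        (by rintro (_ | _ | _ | _ | _ | k) <;> simp [eval, progState]) rfl rfl
    have h2 : RamExec W (.assign 2 (.add (.var 2) (.lit 1)))
        (progState M n i j (a + M (b + j)) b) 4 (progState M n i (j + 1) (a + M (b + j)) b) :=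
      ramExec_assign (by simp only [eval, progState]; omega)
        (by rintro (_ | _ | _ | _ | _ | k) <;> simp [eval, progState]) rfl rfl
    have h3 := ih (j + 1) (a + M (b + j)) (by omega) ha
    have ht : 16 * (k + 1) + 5 =
        (RamExpr.add (.var 2) (.lit 1)).cost + (RamExpr.var 1).cost + 1 + (7 + 4) +
          (16 * k + 5) := by
      simp only [cost]
      omega
    rw [ht]
    exact .loopTrue _ _ _ _ _ _ _ _ (by simp only [eval, progState]; omega)
      (.seq _ _ _ _ _ _ _ h1 h2) h3

/-- The number of ones among the entries below the diagonal in the first `i` rows. -/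
def partialCount (M : ℕ → ℕ) (n i : ℕ) : ℕ :=
  ∑ x ∈ Finset.range i, ∑ y ∈ Finset.range x, M (x * n + y)

theorem partialCount_le {M : ℕ → ℕ} (hM : ∀ a, M a ≤ 1) {n i : ℕ} (hi : i ≤ n) :
    partialCount M n i ≤ n * n := by
  have : ∀ x ∈ Finset.range i, ∑ y ∈ Finset.range x, M (x * n + y) ≤ n := fun x hx => by
    refine (Finset.sum_le_card_nsmul _ _ 1 fun y _ => hM _).trans ?_
    rw [Finset.mem_range] at hx
    simp only [Finset.card_range, smul_eq_mul, mul_one]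
    omega
  refine (Finset.sum_le_card_nsmul _ _ n this).trans ?_
  rw [Finset.card_range, smul_eq_mul]
  exact Nat.mul_le_mul_right n hi

theorem edgesProg_exec {W n : ℕ} {M : ℕ → ℕ} (hM : ∀ a, M a ≤ 1) (hW : n * n + n + 2 ≤ W)
    (k i j : ℕ) (hk : i + k = n) :
    ∃ t j', RamExec W edgesProg (progState M n i j (2 + partialCount M n i) (i * n)) t
        (progState M n n j' (2 + partialCount M n n) (n * n)) ∧
      t ≤ k * (16 * n + 20) + 5 := by
  induction k generalizing i j with
  | zero =>
    obtain rfl : i = n := by omega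
    exact ⟨5, j, .loopFalse _ _ _ _ (by simp [eval, progState]), by omega⟩
  | succ k ih =>
    have hsum : 2 + partialCount M n (i + 1) =
        2 + partialCount M n i + ∑ x ∈ Finset.range i, M (i * n + (0 + x)) := by
      simp only [partialCount, zero_add, Finset.sum_range_succ, add_assoc]
    have hle := partialCount_le hM (show i + 1 ≤ n by omega)
    have hin : (i + 1) * n ≤ n * n := Nat.mul_le_mul_right n (by omega)
    have h1 : RamExec W (.assign 2 (.lit 0))
        (progState M n i j (2 + partialCount M n i) (i * n)) 2
        (progState M n i 0 (2 + partialCount M n i) (i * n)) :=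
      ramExec_assign (by simp [eval])
        (by rintro (_ | _ | _ | _ | _ | k) <;> simp [eval, progState]) rfl rfl
    have h2 := rowProg_exec (W := W) (n := n) (i := i) (b := i * n) M (by omega) i 0
      (2 + partialCount M n i) (by omega) (by rw [← hsum]; omega)
    rw [← hsum] at h2
    have h3 : RamExec W (.assign 4 (.add (.var 4) (.var 0)))
        (progState M n i i (2 + partialCount M n (i + 1)) (i * n)) 4
        (progState M n i i (2 + partialCount M n (i + 1)) ((i + 1) * n)) :=
      ramExec_assign (by simp only [eval, progState]; rw [Nat.succ_mul] at hin; omega)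
        (by rintro (_ | _ | _ | _ | _ | k) <;> simp [eval, progState, Nat.succ_mul]) rfl rfl
    have h4 : RamExec W (.assign 1 (.add (.var 1) (.lit 1)))
        (progState M n i i (2 + partialCount M n (i + 1)) ((i + 1) * n)) 4
        (progState M n (i + 1) i (2 + partialCount M n (i + 1)) ((i + 1) * n)) :=
      ramExec_assign (by simp only [eval, progState]; omega)
        (by rintro (_ | _ | _ | _ | _ | k) <;> simp [eval, progState]) rfl rfl
    obtain ⟨t, j', h5, ht⟩ := ih (i + 1) i (by omega)
    refine ⟨_, j', RamExec.loopTrue (W := W) _ _ _ _ _ _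
      (e := .add (.var 1) (.lit 1)) (f := .var 0)
      (by simp only [eval, progState]; omega)
      (.seq _ _ _ _ _ _ _ h1 (.seq _ _ _ _ _ _ _ h2 (.seq _ _ _ _ _ _ _ h3 h4))) h5, ?_⟩
    simp only [cost]
    have : i ≤ n := by omega
    have := Nat.add_one_mul k (16 * n + 20)
    omega

theorem cactusProg_exec {n : ℕ} (G : SimpleGraph (Fin n)) (hn : 0 < n) :
    ∃ t s, RamExec (47 * n ^ 2) cactusProg (ramInput n G) t s ∧ t ≤ 47 * n ^ 2 ∧
      s.reg 0 = 2 + G.edgeSet.ncard - n := by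
  have h1n : n ≤ n * n := Nat.le_mul_of_pos_left n hn
  have hW : n * n + n + 2 ≤ 47 * n ^ 2 := by rw [sq]; omega
  obtain ⟨t, j, hex, ht⟩ :=
    edgesProg_exec (ramInput_mem_le_one G) hW n 0 0 (zero_add n)
  have hle := partialCount_le (ramInput_mem_le_one G) (le_refl n)
  have h0 : RamExec (47 * n ^ 2) (.assign 3 (.lit 2)) (ramInput n G) 2
      (progState (ramInput n G).mem n 0 0 (2 + partialCount (ramInput n G).mem n 0) (0 * n)) :=
    ramExec_assign (by simp only [eval]; omega)
      (by rintro (_ | _ | _ | _ | _ | k) <;> simp [eval, progState, partialCount, ramInput])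
      rfl rfl
  have h2 : RamExec (47 * n ^ 2) (.assign 0 (.sub (.var 3) (.var 0)))
      (progState (ramInput n G).mem n n j (2 + partialCount (ramInput n G).mem n n) (n * n)) 4
      (progState (ramInput n G).mem (2 + partialCount (ramInput n G).mem n n - n) n j
        (2 + partialCount (ramInput n G).mem n n) (n * n)) :=
    ramExec_assign (by simp only [eval, progState]; omega)
      (by rintro (_ | _ | _ | _ | _ | k) <;> simp [eval, progState]) rfl rfl
  refine ⟨_, _, .seq _ _ _ _ _ _ _ h0 (.seq _ _ _ _ _ _ _ hex h2), ?_, ?_⟩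
  · have : n * (16 * n + 20) = 16 * (n * n) + 20 * n := by ring
    rw [sq]
    omega
  · rw [← sum_ramInput_mem]
    rfl

end Program

end Cactus

theorem mainTheorem3 :
    -- the recurrence computes `Z₀`
    (∀ (V : Type u) [Fintype V] (G : SimpleGraph V), G.Connected → IsCactus G →
      ZPlus G = Zq G 0 ∧
      (∃ T, IsTreeRep G T) ∧
      ∀ T, IsTreeRep G T →
        ((Zq G 0 : ℕ∞) =
          ⨅ r : CactusNode G, ⨅ k, dpVal T (fun C => IsCycleSet G C.1) r r 0 k) ∧
        -- what the values mean for each subtree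
        (∀ r C : CactusNode G,
          (⨅ k, dpVal T (fun C => IsCycleSet G C.1) r C 0 k) =
            Zq (G.induce (subtreeVerts G T r C)) 0) ∧
        (∀ (r P C : CactusNode G) (p : V), C ∈ children T r P → AttachedAt G C P p →
          (⨅ k, dpVal T (fun C => IsCycleSet G C.1) r C 1 k) =
            tokensNeeded (G.induce (subtreeVerts G T r C)) 0 {x | x.1 = p})) ∧
    -- the evaluation of the recurrence for all rootings takes `O(n²)` steps
    (∃ K : ℕ, ∀ (V : Type u) [Fintype V] (G : SimpleGraph V), G.Connected → IsCactus G →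
      ∀ T, IsTreeRep G T →
        (∀ (r C : CactusNode G) (i : Fin 2) (j : Fin 3),
          (evalTree T (fun C => IsCycleSet G C.1) r C).val i j =
            dpVal T (fun C => IsCycleSet G C.1) r C i j) ∧
        ((Zq G 0 : ℕ∞) =
          ⨅ r : CactusNode G, (evalTree T (fun C => IsCycleSet G C.1) r r).dp 0) ∧
        evalAllOps T (fun C => IsCycleSet G C.1) ≤ K * Fintype.card V ^ 2) ∧
    -- a program that computes `Z₀` from the graph in `O(n²)` steps
    (∃ (P : RamProg) (K : ℕ), ∀ (n : ℕ) (G : SimpleGraph (Fin n)), G.Connected → IsCactus G →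
      ∃ (t : ℕ) (s : RamState), RamExec (K * n ^ 2) P (ramInput n G) t s ∧
        t ≤ K * n ^ 2 ∧ s.reg 0 = Zq G 0 ∧ s.reg 0 = ZPlus G) := by
  refine ⟨fun V _ G hconn hG => ⟨?_, Cactus.exists_isTreeRep hconn, fun T hT => ⟨?_, ?_, ?_⟩⟩,
    ⟨56, fun V _ G hconn hG T hT => ⟨?_, ?_, ?_⟩⟩,
    ⟨Cactus.cactusProg, 47, fun n G hconn hG => ?_⟩⟩
  · rw [Cactus.ZPlus_eq hconn hG, Cactus.Zq_zero_eq hconn hG]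
  · have := hT.1.connected.nonempty
    refine (ciInf_const (ι := CactusNode G)).symm.trans (iInf_congr fun r => ?_)
    rw [(Cactus.min_dpVal_eq hT.1 _ r r).1, Cactus.Zq_eq_subtreeCycles_root hconn hG hT r,
      Nat.cast_add, Nat.cast_one]
    rfl
  · intro r C
    rw [(Cactus.min_dpVal_eq hT.1 _ r C).1, Cactus.Zq_subtreeVerts hG hT, Nat.cast_add,
      Nat.cast_one]
    rfl
  · intro r P C p _ hp
    rw [(Cactus.min_dpVal_eq hT.1 _ r C).2, Cactus.tokensNeeded_subtreeVerts hG hT hp.1]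
    rfl
  · intro r C i j
    rw [(Cactus.evalTree_spec hT.1 _ r C).1]
  · have := hT.1.connected.nonempty
    refine (ciInf_const (ι := CactusNode G)).symm.trans (iInf_congr fun r => ?_)
    rw [(Cactus.evalTree_spec hT.1 _ r r).2.1, Cactus.Zq_eq_subtreeCycles_root hconn hG hT r,
      Nat.cast_add, Nat.cast_one]
    rfl
  · have h := Cactus.card_cactusNode_le hconn hG
    rw [Nat.card_eq_fintype_card] at h
    calc _ ≤ 14 * Fintype.card (CactusNode G) ^ 2 := Cactus.evalAllOps_le hT.1 _
      _ ≤ 14 * (2 * Fintype.card V) ^ 2 := by gcongr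
      _ = 56 * Fintype.card V ^ 2 := by ring
  · have hn : 0 < n := Fin.pos_iff_nonempty.2 hconn.nonempty
    obtain ⟨t, s, hex, ht, hs⟩ := Cactus.cactusProg_exec G hn
    have h := Cactus.ncard_isCycleSet_add_card hconn hG
    rw [Nat.card_eq_fintype_card, Fintype.card_fin] at h
    refine ⟨t, s, hex, ht, ?_, ?_⟩
    · rw [hs, Cactus.Zq_zero_eq hconn hG]
      omega
    · rw [hs, Cactus.ZPlus_eq hconn hG]
      omega
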